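/- Let $\mathbb R^4$ carry its standard Euclidean metric and let $\kappa>0$. A homogeneous cubic polynomial $P$ on $\mathbb R^4$ is said to solve the system with constant $\kappa$ if $$\Delta P=0,\qquad |\mathrm{Hess}\,P|^2=\sum_{i,j}(\partial_i\partial_jP)^2=\kappa|x|^2 .$$ $P$ is orthogonally decomposable if $\mathbb R^4=V\oplus W$ with $V,W$ nonzero orthogonal subspaces and $P(v+w)=P(v)+P(w)$ for all $v\in V$, $w\in W$; otherwise it is orthogonally indecomposable. Two polynomials are $O(4)$-equivalent if they lie in one orbit of the action $(g\cdot P)(x)=P(g^{-1}x)$ of $O(4)$. A critical line of $P$ is a line spanned by a nonzero vector $v$ such that $\langle v,\cdot\rangle\wedge dP(v)=0$. Let $$S_\kappa(x)=\tfrac{\sqrt{3\kappa}}{12}\left(x_4^3-x_4(x_1^2+x_2^2+x_3^2)+2\sqrt5\,x_1x_2x_3\right).$$ (1) A homogeneous cubic polynomial $P$ on $\mathbb R^4$ is orthogonally indecomposable and solves the system with constant $\kappa$ if and only if it is $O(4)$-equivalent to $S_\kappa$. (In particular $S_\kappa$ is itself orthogonally indecomposable.) (2) For every such $P$, the automorphism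 group $\{g\in GL(4,\mathbb R): g\cdot P=P\}$ consists of orthogonal transformations and is isomorphic to the symmetric group $S_5$. (3) $S_\kappa$ has exactly $15$ critical lines, namely those spanned by $(0,0,0,1)$; by $(\epsilon_1\sqrt5,\epsilon_2\sqrt5,\epsilon_3\sqrt5,-1)$ and $(\epsilon_1\sqrt5,\epsilon_2\sqrt5,\epsilon_3\sqrt5,3)$ with $\epsilon_i\in\{1,-1\}$, $\epsilon_1\epsilon_2\epsilon_3=1$; and by $(\pm\sqrt5,0,0,1)$, $(0,\pm\sqrt5,0,1)$, $(0,0,\pm\sqrt5,1)$. No two of these lines are orthogonal. -/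

import Mathlib

noncomputable section

/-- The Laplacian of a polynomial on Euclidean `ℝⁿ`. -/
def polyLaplacian {n : ℕ} (P : MvPolynomial (Fin n) ℝ) : MvPolynomial (Fin n) ℝ :=
  ∑ i, MvPolynomial.pderiv i (MvPolynomial.pderiv i P)

/-- The squared norm `|Hess P|² = ∑ᵢⱼ (∂ᵢ∂ⱼP)²` of the Hessian of a polynomial on `ℝⁿ`. -/
def polyHessNormSq {n : ℕ} (P : MvPolynomial (Fin n) ℝ) : MvPolynomial (Fin n) ℝ :=
  ∑ i, ∑ j, (MvPolynomial.pderiv i (MvPolynomial.pderiv j P)) ^ 2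

/-- `P` solves the system `ΔP = 0`, `|Hess P|² = κ |x|²`. -/
structure SolvesSystem {n : ℕ} (κ : ℝ) (P : MvPolynomial (Fin n) ℝ) : Prop where
  harmonic : polyLaplacian P = 0
  hess_sq : polyHessNormSq P =
    MvPolynomial.C κ * ∑ i, (MvPolynomial.X i : MvPolynomial (Fin n) ℝ) ^ 2

/-- The function on Euclidean `ℝⁿ` defined by a polynomial. -/
def polyFun {n : ℕ} (P : MvPolynomial (Fin n) ℝ) (x : EuclideanSpace ℝ (Fin n)) : ℝ :=
  MvPolynomial.eval (fun i => x i) P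

/-- The left action `(g · F)(x) = F(g⁻¹x)` of `GL(n, ℝ)` on functions on `ℝⁿ`. -/
def linAct {n : ℕ} (g : EuclideanSpace ℝ (Fin n) ≃ₗ[ℝ] EuclideanSpace ℝ (Fin n))
    (F : EuclideanSpace ℝ (Fin n) → ℝ) : EuclideanSpace ℝ (Fin n) → ℝ :=
  fun x => F (g⁻¹ x)

/-- `P` and `Q` lie in the same `O(n)`-orbit. -/
def OrthogonallyEquivalent {n : ℕ} (P Q : MvPolynomial (Fin n) ℝ) : Prop :=
  ∃ g : EuclideanSpace ℝ (Fin n) ≃ₗᵢ[ℝ] EuclideanSpace ℝ (Fin n),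
    polyFun P = linAct g.toLinearEquiv (polyFun Q)

/-- `P` decomposes along a direct sum of two nonzero orthogonal subspaces. -/
def OrthogonallyDecomposable {n : ℕ} (P : MvPolynomial (Fin n) ℝ) : Prop :=
  ∃ V W : Submodule ℝ (EuclideanSpace ℝ (Fin n)),
    V ≠ ⊥ ∧ W ≠ ⊥ ∧ IsCompl V W ∧ V.IsOrtho W ∧
      ∀ v ∈ V, ∀ w ∈ W, polyFun P (v + w) = polyFun P v + polyFun P w

/-- The automorphism group of `P`: its stabilizer in the full linear group `GL(n, ℝ)`. -/
def polyAut {n : ℕ} (P : MvPolynomial (Fin n) ℝ) :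
    Subgroup (EuclideanSpace ℝ (Fin n) ≃ₗ[ℝ] EuclideanSpace ℝ (Fin n)) where
  carrier := {g | linAct g (polyFun P) = polyFun P}
  one_mem' := rfl
  mul_mem' := by
    intro a b ha hb
    funext x
    have h1 := congrFun ha x
    have h2 := congrFun hb (a⁻¹ x)
    simp only [linAct] at h1 h2 ⊢
    rw [mul_inv_rev, LinearEquiv.mul_apply, h2, h1]
  inv_mem' := by
    intro a ha
    funext x
    have h1 := congrFun ha (a x)
    have h3 : a⁻¹ (a x) = x := a.symm_apply_apply x
    simp only [linAct, h3] at h1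
    simp only [linAct, inv_inv]
    exact h1.symm

/-- `v` satisfies `⟨v, ·⟩ ∧ dP(v) = 0`. -/
def IsCriticalVector {n : ℕ} (P : MvPolynomial (Fin n) ℝ)
    (v : EuclideanSpace ℝ (Fin n)) : Prop :=
  ∀ i j, v i * polyFun (MvPolynomial.pderiv j P) v = v j * polyFun (MvPolynomial.pderiv i P) v

/-- The critical lines of `P`: the one-dimensional subspaces spanned by a nonzero `v` such that
`⟨v, ·⟩ ∧ dP(v) = 0`. -/
def criticalLines {n : ℕ} (P : MvPolynomial (Fin n) ℝ) :
    Set (Submodule ℝ (EuclideanSpace ℝ (Fin n))) :=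
  {ℓ | ∃ v : EuclideanSpace ℝ (Fin n), v ≠ 0 ∧ IsCriticalVector P v ∧ ℓ = Submodule.span ℝ {v}}

/-- The simplicial cubic form
`(√(3κ)/12) (x₄³ - x₄(x₁² + x₂² + x₃²) + 2√5 x₁x₂x₃)` on `ℝ⁴`
(the coordinates `x₁, x₂, x₃, x₄` have the indices `0, 1, 2, 3`). -/
def simplicialForm (κ : ℝ) : MvPolynomial (Fin 4) ℝ :=
  MvPolynomial.C (Real.sqrt (3 * κ) / 12) *
    (MvPolynomial.X 3 ^ 3
      - MvPolynomial.X 3 * (MvPolynomial.X 0 ^ 2 + MvPolynomial.X 1 ^ 2 + MvPolynomial.X 2 ^ 2)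
      + MvPolynomial.C (2 * Real.sqrt 5) *
        (MvPolynomial.X 0 * MvPolynomial.X 1 * MvPolynomial.X 2))

/-- Generators of the fifteen critical lines of the simplicial form. -/
def simplicialGenerator : Fin 15 → EuclideanSpace ℝ (Fin 4) :=
  ![!₂[0, 0, 0, 1],
    !₂[√5, -√5, -√5, -1], !₂[-√5, √5, -√5, -1], !₂[-√5, -√5, √5, -1], !₂[√5, √5, √5, -1],
    !₂[√5, -√5, -√5, 3], !₂[-√5, √5, -√5, 3], !₂[-√5, -√5, √5, 3], !₂[√5, √5, √5, 3],
    !₂[√5, 0, 0, 1], !₂[-√5, 0, 0, 1],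
    !₂[0, √5, 0, 1], !₂[0, -√5, 0, 1],
    !₂[0, 0, √5, 1], !₂[0, 0, -√5, 1]]

end

set_option linter.unusedSimpArgs false

noncomputable section

/-! A cubic form is encoded by its third derivative `T`, a symmetric trilinear form. The system says
that the traces of `T` vanish and that `x ↦ T x` multiplies inner products by `κ`, with the
Frobenius product on bilinear forms. Both conditions can be read off in any orthonormal basis
(`SolvesSystem.sum_polarForm`).

Uniqueness. Let `e` maximise the cubic on the unit sphere, with `T e e e = m`, and diagonalise `T e`
on the complement of `e`. The system becomes polynomial equations in the eigenvalues and the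
remaining coefficients. Together with the second-order condition that eigenvalues are at most `m /
2`, they leave two cases (`scalar_or_split_of_tensor`): the eigenvalues coincide, or two of them
vanish and the form splits along two orthogonal planes. Indecomposability rules out the second case.
Maximising again on the complement of `e`, and once more on the complement of the first two vectors,
then determines every coefficient (`normalForm_of_tensor`). Hence any two indecomposable solutions
are equivalent. The normal form is never compared with `simplicialForm` directly: it suffices that
the latter is itself an indecomposable solution.

Existence. `simplicialForm` is a multiple of `∑ ⟨wᵢ, x⟩³` for the vertices `wᵢ` of a regular
simplex. The coordinates `⟨wᵢ, x⟩` identify `ℝ⁴` with the vectors of `ℝ⁵` of coordinate sum zero, on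
which the form is a multiple of the sum of cubes. The system becomes a computation with the Gram
matrix, and indecomposability a statement about vanishing coordinates.

Automorphisms. Every linear automorphism preserves the relation `T u v = 0`. A nonzero `u` so
related to two independent vectors is parallel to an edge of the simplex
(`IsSimplexFrame.exists_edge`), so edges go to multiples of edges. The values of `T` on pairs of
edges fix the multiples and the incidences, so the vertices are permuted; conversely every
permutation of the vertices is realised by an isometry.

Critical lines. The equations are solved by hand. The fifteen lines are those through the five
vertices and the ten edge midpoints of the simplex. -/

/-! ### The third derivative of a cubic form, and the system in orthonormal bases -/

open MvPolynomial in
theorem MvPolynomial.pderiv_comm {σ R : Type*} [CommRing R] (i j : σ) (p : MvPolynomial σ R) :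
    pderiv i (pderiv j p) = pderiv j (pderiv i p) := by
  classical
  ext m
  simp only [coeff_pderiv]
  by_cases h : i = j
  · rw [h]
  · have h' : j ≠ i := fun h' => h h'.symm
    simp only [Finsupp.add_apply, Finsupp.single_apply, h, h', if_false, add_zero]
    rw [add_right_comm]
    ring

/-- A symmetric trilinear form `T` with `P(x) = T(x, x, x) / 6`; for a cubic form this is the
third derivative of `P`. -/
structure IsPolarForm {n : ℕ} (P : MvPolynomial (Fin n) ℝ)
    (T : EuclideanSpace ℝ (Fin n) →ₗ[ℝ] EuclideanSpace ℝ (Fin n) →ₗ[ℝ]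
      EuclideanSpace ℝ (Fin n) →ₗ[ℝ] ℝ) : Prop where
  swap_left : ∀ x y z, T x y z = T y x z
  swap_right : ∀ x y z, T x y z = T x z y
  diag : ∀ x, T x x x = 6 * polyFun P x

/-- The trilinear form with the given coefficients in the standard basis. -/
def trilinearOfCoeff {n : ℕ} (c : Fin n → Fin n → Fin n → ℝ) :
    EuclideanSpace ℝ (Fin n) →ₗ[ℝ] EuclideanSpace ℝ (Fin n) →ₗ[ℝ]
      EuclideanSpace ℝ (Fin n) →ₗ[ℝ] ℝ :=
  ∑ i, ∑ j, ∑ k, c i j k •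
    (EuclideanSpace.proj i : EuclideanSpace ℝ (Fin n) →L[ℝ] ℝ).toLinearMap.smulRight
      ((EuclideanSpace.proj j : EuclideanSpace ℝ (Fin n) →L[ℝ] ℝ).toLinearMap.smulRight
        (EuclideanSpace.proj k : EuclideanSpace ℝ (Fin n) →L[ℝ] ℝ).toLinearMap)

theorem trilinearOfCoeff_apply {n : ℕ} (c : Fin n → Fin n → Fin n → ℝ)
    (x y z : EuclideanSpace ℝ (Fin n)) :
    trilinearOfCoeff c x y z = ∑ i, ∑ j, ∑ k, c i j k * (x i * (y j * z k)) := by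
  simp [trilinearOfCoeff, LinearMap.sum_apply]

-- The third partial derivatives of `P` are constants. Euler's identity in degrees 1, 2 and 3
-- recovers from them the second derivatives, the gradient and `P`, whence the factor `6 = 3 · 2`.
open MvPolynomial in
theorem MvPolynomial.IsHomogeneous.exists_isPolarForm {n : ℕ} {P : MvPolynomial (Fin n) ℝ}
    (hP : P.IsHomogeneous 3) :
    ∃ T, IsPolarForm P T ∧ ∀ i j x, eval (fun k => x k) (pderiv i (pderiv j P)) =
      T (EuclideanSpace.single i 1) (EuclideanSpace.single j 1) x := by
  classical
  set c : Fin n → Fin n → Fin n → ℝ :=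
    fun i j k => coeff 0 (pderiv k (pderiv i (pderiv j P))) with hc
  have h3 : ∀ i j k, pderiv k (pderiv i (pderiv j P)) = C (c i j k) := by
    intro i j k
    have h : (pderiv k (pderiv i (pderiv j P))).IsHomogeneous 0 := hP.pderiv.pderiv.pderiv
    rw [← totalDegree_zero_iff_isHomogeneous, totalDegree_eq_zero_iff_eq_C] at h
    exact h
  have e1 : ∀ i j, ∑ k, X k * C (c i j k) = pderiv i (pderiv j P) := by
    intro i j
    have h : (pderiv i (pderiv j P)).IsHomogeneous 1 := hP.pderiv.pderiv
    have := h.sum_X_mul_pderiv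
    simpa [h3] using this
  have e2 : ∀ j, ∑ i, X i * pderiv i (pderiv j P) = 2 • pderiv j P := fun j =>
    IsHomogeneous.sum_X_mul_pderiv (n := 2) hP.pderiv
  have e3 := hP.sum_X_mul_pderiv
  have s1 : ∀ i j k, c i j k = c j i k := by
    intro i j k
    simp only [hc]; rw [pderiv_comm i j]
  have s2 : ∀ i j k, c i j k = c i k j := by
    intro i j k
    simp only [hc]; rw [pderiv_comm i j, pderiv_comm k j, pderiv_comm k i]
  have v1 : ∀ i j (x : EuclideanSpace ℝ (Fin n)),
      eval (fun k => x k) (pderiv i (pderiv j P)) = ∑ k, x k * c i j k := by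
    intro i j x
    rw [← e1 i j]; simp
  have v2 : ∀ j (x : EuclideanSpace ℝ (Fin n)),
      2 * eval (fun k => x k) (pderiv j P) = ∑ i, x i * ∑ k, x k * c i j k := by
    intro j x
    have := congrArg (eval fun k => x k) (e2 j)
    simp only [map_sum, map_mul, eval_X, v1, nsmul_eq_mul, map_natCast] at this
    exact_mod_cast this.symm
  have v3 : ∀ (x : EuclideanSpace ℝ (Fin n)),
      6 * eval (fun k => x k) P = ∑ j, x j * ∑ i, x i * ∑ k, x k * c i j k := by
    intro x
    have := congrArg (eval fun k => x k) e3
    simp only [map_sum, map_mul, eval_X, nsmul_eq_mul, map_natCast] at this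
    simp only [← v2]
    calc _ = 2 * (((3 : ℕ) : ℝ) * eval (fun k => x k) P) := by push_cast; ring
      _ = _ := by rw [← this, Finset.mul_sum]; exact Finset.sum_congr rfl fun j _ => by ring
  refine ⟨trilinearOfCoeff c, ⟨?_, ?_, ?_⟩, ?_⟩
  · intro x y z
    rw [trilinearOfCoeff_apply, trilinearOfCoeff_apply, Finset.sum_comm]
    refine Finset.sum_congr rfl fun i _ => Finset.sum_congr rfl fun j _ =>
      Finset.sum_congr rfl fun k _ => ?_
    rw [s1]; ring
  · intro x y z
    rw [trilinearOfCoeff_apply, trilinearOfCoeff_apply]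
    refine Finset.sum_congr rfl fun i _ => ?_
    rw [Finset.sum_comm]
    refine Finset.sum_congr rfl fun j _ => Finset.sum_congr rfl fun k _ => ?_
    rw [s2]; ring
  · intro x
    rw [trilinearOfCoeff_apply, polyFun, v3, Finset.sum_comm]
    refine Finset.sum_congr rfl fun j _ => ?_
    rw [Finset.mul_sum]
    refine Finset.sum_congr rfl fun i _ => ?_
    rw [Finset.mul_sum, Finset.mul_sum]
    exact Finset.sum_congr rfl fun k _ => by ring
  · intro i j x
    rw [trilinearOfCoeff_apply, v1]
    simp [PiLp.single_apply, mul_comm]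

theorem IsPolarForm.apply_eq {n : ℕ} {P : MvPolynomial (Fin n) ℝ}
    {T : EuclideanSpace ℝ (Fin n) →ₗ[ℝ] EuclideanSpace ℝ (Fin n) →ₗ[ℝ]
      EuclideanSpace ℝ (Fin n) →ₗ[ℝ] ℝ} (h : IsPolarForm P T) (x y z : EuclideanSpace ℝ (Fin n)) :
    T x y z = polyFun P (x + y + z) - polyFun P (x + y) - polyFun P (x + z) - polyFun P (y + z)
      + polyFun P x + polyFun P y + polyFun P z := by
  have e1 := h.diag (x + y + z)
  have e2 := h.diag (x + y)
  have e3 := h.diag (x + z)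
  have e4 := h.diag (y + z)
  have e5 := h.diag x
  have e6 := h.diag y
  have e7 := h.diag z
  simp only [map_add, LinearMap.add_apply] at e1 e2 e3 e4
  have a1 := h.swap_left y x z
  have a2 := h.swap_right x z y
  have a3 := h.swap_left z x y
  have a4 := h.swap_right z y x
  have a5 := h.swap_right y z x
  linarith

/-- The system in terms of the third derivative. -/
theorem solvesSystem_iff {n : ℕ} {κ : ℝ} {P : MvPolynomial (Fin n) ℝ}
    {T : EuclideanSpace ℝ (Fin n) →ₗ[ℝ] EuclideanSpace ℝ (Fin n) →ₗ[ℝ]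
      EuclideanSpace ℝ (Fin n) →ₗ[ℝ] ℝ}
    (hT : ∀ i j x, MvPolynomial.eval (fun k => x k)
      (MvPolynomial.pderiv i (MvPolynomial.pderiv j P)) =
      T (EuclideanSpace.single i 1) (EuclideanSpace.single j 1) x) :
    SolvesSystem κ P ↔
      (∀ x, ∑ i, T (EuclideanSpace.single i 1) (EuclideanSpace.single i 1) x = 0) ∧
      ∀ x, ∑ i, ∑ j, T (EuclideanSpace.single i 1) (EuclideanSpace.single j 1) x ^ 2
        = κ * ‖x‖ ^ 2 := by
  constructor
  · intro h
    constructor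
    · intro x
      have := congrArg (MvPolynomial.eval fun k => x k) h.harmonic
      simpa [polyLaplacian, hT] using this
    · intro x
      have := congrArg (MvPolynomial.eval fun k => x k) h.hess_sq
      rw [EuclideanSpace.real_norm_sq_eq]
      simpa [polyHessNormSq, hT] using this
  · rintro ⟨h1, h2⟩
    constructor
    · apply MvPolynomial.funext
      intro x
      have := h1 (WithLp.toLp 2 x)
      simp only [← hT] at this
      simpa [polyLaplacian] using this
    · apply MvPolynomial.funext
      intro x
      have := h2 (WithLp.toLp 2 x)
      rw [EuclideanSpace.real_norm_sq_eq] at this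
      simp only [← hT] at this
      simpa [polyHessNormSq] using this

theorem sum_apply_orthonormalBasis_eq {n : ℕ} {E : Type*} [NormedAddCommGroup E]
    [InnerProductSpace ℝ E] (B : E →ₗ[ℝ] E →ₗ[ℝ] ℝ) (b b' : OrthonormalBasis (Fin n) ℝ E) :
    ∑ i, B (b i) (b i) = ∑ i, B (b' i) (b' i) := by
  have key : ∀ i, B (b i) (b i) =
      ∑ k, ∑ l, inner ℝ (b' k) (b i) * inner ℝ (b i) (b' l) * B (b' k) (b' l) := by
    intro i
    conv_lhs => rw [← b'.sum_repr' (b i)]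
    simp only [map_sum, LinearMap.sum_apply, map_smul, LinearMap.smul_apply, smul_eq_mul,
      Finset.mul_sum]
    rw [Finset.sum_comm]
    refine Finset.sum_congr rfl fun k _ => Finset.sum_congr rfl fun l _ => ?_
    rw [real_inner_comm (b i) (b' l)]; ring
  simp only [key]
  rw [Finset.sum_comm]
  refine Finset.sum_congr rfl fun k _ => ?_
  rw [Finset.sum_comm]
  simp only [← Finset.sum_mul, b.sum_inner_mul_inner]
  rw [Finset.sum_eq_single k]
  · simp
  · intro l _ hl
    rw [b'.inner_eq_zero hl.symm, zero_mul]
  · simp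

theorem sum_sum_apply_orthonormalBasis_eq {n : ℕ} {E : Type*} [NormedAddCommGroup E]
    [InnerProductSpace ℝ E] (A B : E →ₗ[ℝ] E →ₗ[ℝ] ℝ) (b b' : OrthonormalBasis (Fin n) ℝ E) :
    ∑ i, ∑ j, A (b i) (b j) * B (b i) (b j) = ∑ i, ∑ j, A (b' i) (b' j) * B (b' i) (b' j) := by
  have h1 : ∀ i, ∑ j, A (b i) (b j) * B (b i) (b j) = ∑ j, A (b i) (b' j) * B (b i) (b' j) := by
    intro i
    -- The bilinear form is `(x, y) ↦ A (b i) x * B (b i) y`; its trace does not depend on the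
    -- basis. Changing one index at a time gives the Frobenius product.
    have := sum_apply_orthonormalBasis_eq
      (LinearMap.mul' ℝ ℝ ∘ₗ TensorProduct.map (A (b i)) (B (b i)) |> TensorProduct.curry) b b'
    simpa using this
  have h2 : ∀ j, ∑ i, A (b i) (b' j) * B (b i) (b' j) =
      ∑ i, A (b' i) (b' j) * B (b' i) (b' j) := by
    intro j
    have := sum_apply_orthonormalBasis_eq
      (LinearMap.mul' ℝ ℝ ∘ₗ TensorProduct.map (A.flip (b' j)) (B.flip (b' j)) |>
        TensorProduct.curry) b b'
    simpa using this
  simp only [h1]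
  rw [Finset.sum_comm]
  simp only [h2]
  rw [Finset.sum_comm]

/-- The system in terms of the third derivative, in an arbitrary orthonormal basis. -/
theorem SolvesSystem.sum_polarForm {n : ℕ} {κ : ℝ} {P : MvPolynomial (Fin n) ℝ}
    {T : EuclideanSpace ℝ (Fin n) →ₗ[ℝ] EuclideanSpace ℝ (Fin n) →ₗ[ℝ]
      EuclideanSpace ℝ (Fin n) →ₗ[ℝ] ℝ}
    (h : SolvesSystem κ P) (hs : IsPolarForm P T)
    (hT : ∀ i j x, MvPolynomial.eval (fun k => x k)
      (MvPolynomial.pderiv i (MvPolynomial.pderiv j P)) =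
      T (EuclideanSpace.single i 1) (EuclideanSpace.single j 1) x)
    (b : OrthonormalBasis (Fin n) ℝ (EuclideanSpace ℝ (Fin n))) :
    (∀ x, ∑ i, T x (b i) (b i) = 0) ∧
      ∀ x y, ∑ i, ∑ j, T x (b i) (b j) * T y (b i) (b j) = κ * inner ℝ x y := by
  obtain ⟨h1, h2⟩ := (solvesSystem_iff hT).1 h
  have perm : ∀ x y z, T x y z = T z x y := fun x y z => by rw [hs.swap_right, hs.swap_left]
  have h2' : ∀ x, ∑ i, ∑ j, T x (b i) (b j) ^ 2 = κ * ‖x‖ ^ 2 := by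
    intro x
    rw [← h2 x]
    have := sum_sum_apply_orthonormalBasis_eq (T x) (T x) b (EuclideanSpace.basisFun (Fin n) ℝ)
    simp only [← sq] at this
    rw [this]
    simp [EuclideanSpace.basisFun_apply, perm _ _ x]
  refine ⟨fun x => ?_, fun x y => ?_⟩
  · rw [sum_apply_orthonormalBasis_eq (T x) b (EuclideanSpace.basisFun (Fin n) ℝ), ← h1 x]
    simp [EuclideanSpace.basisFun_apply, perm _ _ x]
  -- Polarisation of the quadratic identity `h2'`.
  · have hxy := h2' (x + y)
    have hx := h2' x
    have hy := h2' y
    rw [norm_add_sq_real] at hxy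
    have : ∑ i, ∑ j, T (x + y) (b i) (b j) ^ 2 = ∑ i, ∑ j, T x (b i) (b j) ^ 2 +
        2 * ∑ i, ∑ j, T x (b i) (b j) * T y (b i) (b j) + ∑ i, ∑ j, T y (b i) (b j) ^ 2 := by
      simp only [Finset.mul_sum, ← Finset.sum_add_distrib]
      refine Finset.sum_congr rfl fun i _ => Finset.sum_congr rfl fun j _ => ?_
      simp only [map_add, LinearMap.add_apply]; ring
    linarith

/-! ### Maximum points on unit spheres -/

/-- Dividing by `t`, then by `t ^ 2`, and letting `t` tend to zero. This supplies the first- and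
second-order conditions at a maximum without differentiating on the sphere. -/
theorem eq_zero_and_nonpos_of_quartic_nonpos {a b c d : ℝ}
    (h : ∀ t : ℝ, a * t + b * t ^ 2 + c * t ^ 3 + d * t ^ 4 ≤ 0) : a = 0 ∧ b ≤ 0 := by
  have hcont : ∀ p q r s : ℝ, (∀ t : ℝ, 0 < t → p + q * t + r * t ^ 2 + s * t ^ 3 ≤ 0) → p ≤ 0 := by
    intro p q r s hp
    have ht : Filter.Tendsto (fun t : ℝ => p + q * t + r * t ^ 2 + s * t ^ 3)
        (nhdsWithin 0 (Set.Ioi 0)) (nhds (p + q * 0 + r * 0 ^ 2 + s * 0 ^ 3)) :=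
      (Continuous.tendsto (by fun_prop) 0).mono_left nhdsWithin_le_nhds
    have := le_of_tendsto ht (by
      filter_upwards [self_mem_nhdsWithin] with t ht using hp t ht)
    simpa using this
  have ha1 : a ≤ 0 := hcont a b c d fun t ht => by
    have := h t
    by_contra! hlt
    nlinarith [mul_pos ht hlt]
  have ha2 : -a ≤ 0 := hcont (-a) b (-c) d fun t ht => by
    have := h (-t)
    by_contra! hlt
    nlinarith [mul_pos ht hlt]
  have ha : a = 0 := by linarith
  subst ha
  refine ⟨rfl, hcont b c d 0 fun t ht => ?_⟩
  have := h t
  by_contra! hlt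
  nlinarith [mul_pos (pow_pos ht 2) hlt]

section Maximum

variable {E : Type*} [NormedAddCommGroup E] [InnerProductSpace ℝ E] [FiniteDimensional ℝ E]

theorem Submodule.exists_norm_eq_one_forall_le {F : Submodule ℝ E} (hF : F ≠ ⊥) {f : E → ℝ}
    (hf : Continuous f) : ∃ e ∈ F, ‖e‖ = 1 ∧ ∀ x ∈ F, ‖x‖ = 1 → f x ≤ f e := by
  have hK : IsCompact ((F : Set E) ∩ Metric.sphere 0 1) :=
    (isCompact_sphere (0 : E) 1).inter_left F.closed_of_finiteDimensional
  obtain ⟨v, hv, hv0⟩ := F.exists_mem_ne_zero_of_ne_bot hF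
  have hne : ((F : Set E) ∩ Metric.sphere 0 1).Nonempty := by
    refine ⟨‖v‖⁻¹ • v, F.smul_mem _ hv, ?_⟩
    simp [norm_smul, hv0]
  obtain ⟨e, ⟨heF, he1⟩, he⟩ := hK.exists_isMaxOn hne hf.continuousOn
  exact ⟨e, heF, by simpa using he1, fun x hx hx1 => he ⟨hx, by simpa using hx1⟩⟩

theorem LinearMap.continuous_apply_apply_self (B : E →ₗ[ℝ] E →ₗ[ℝ] ℝ) :
    Continuous fun x => B x x := by
  have h : Continuous fun x => LinearMap.toContinuousLinearMap (B x) :=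
    (LinearMap.toContinuousLinearMap.toLinearMap ∘ₗ B).continuous_of_finiteDimensional
  exact h.clm_apply continuous_id

theorem LinearMap.continuous_apply_apply_apply_self (T : E →ₗ[ℝ] E →ₗ[ℝ] E →ₗ[ℝ] ℝ) :
    Continuous fun x => T x x x := by
  let b := Module.finBasis ℝ E
  have : (fun x => T x x x) = fun x => ∑ i, b.repr x i * T (b i) x x := by
    funext x
    have hx : T x = ∑ i, b.repr x i • T (b i) := by
      conv_lhs => rw [← b.sum_repr x]
      rw [map_sum]
      exact Finset.sum_congr rfl fun i _ => map_smul _ _ _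
    rw [hx]
    simp [LinearMap.sum_apply]
  rw [this]
  refine continuous_finsetSum _ fun i _ => ?_
  exact (b.coord i).continuous_of_finiteDimensional.mul (T (b i)).continuous_apply_apply_self

/-- A maximum point of a quadratic form on the unit sphere of a subspace is an eigenvector. -/
theorem Submodule.exists_norm_eq_one_forall_orthogonal {F : Submodule ℝ E} (hF : F ≠ ⊥)
    (B : E →ₗ[ℝ] E →ₗ[ℝ] ℝ) (hB : ∀ x y, B x y = B y x) :
    ∃ e ∈ F, ‖e‖ = 1 ∧ ∀ v ∈ F, inner ℝ e v = 0 → B e v = 0 := by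
  obtain ⟨e, heF, he1, hmax⟩ := F.exists_norm_eq_one_forall_le hF B.continuous_apply_apply_self
  have hmax' : ∀ x ∈ F, B x x ≤ B e e * ‖x‖ ^ 2 := by
    intro x hx
    rcases eq_or_ne x 0 with rfl | hx0
    · simp
    have hn : 0 < ‖x‖ := norm_pos_iff.2 hx0
    have := hmax (‖x‖⁻¹ • x) (F.smul_mem _ hx) (by simp [norm_smul, hx0])
    simp only [map_smul, LinearMap.smul_apply, smul_eq_mul] at this
    calc B x x = (‖x‖⁻¹ * (‖x‖⁻¹ * B x x)) * ‖x‖ ^ 2 := by field_simp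
      _ ≤ _ := by gcongr
  refine ⟨e, heF, he1, fun v hv hev => ?_⟩
  have := (eq_zero_and_nonpos_of_quartic_nonpos (a := 2 * B e v)
    (b := B v v - B e e * ‖v‖ ^ 2) (c := 0) (d := 0) fun t => ?_).1
  · linarith
  have h := hmax' (e + t • v) (F.add_mem heF (F.smul_mem t hv))
  rw [norm_add_sq_real, inner_smul_right, hev, he1, norm_smul, mul_pow, Real.norm_eq_abs,
    sq_abs] at h
  simp only [map_add, LinearMap.add_apply, map_smul, LinearMap.smul_apply, smul_eq_mul,
    hB v e] at h
  linarith

/-- First and second order conditions at a maximum point of a cubic form on the unit sphere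
of a subspace. -/
theorem Submodule.exists_norm_eq_one_cubic_max {F : Submodule ℝ E} (hF : F ≠ ⊥)
    (T : E →ₗ[ℝ] E →ₗ[ℝ] E →ₗ[ℝ] ℝ) (h1 : ∀ x y z, T x y z = T y x z)
    (h2 : ∀ x y z, T x y z = T x z y) :
    ∃ e ∈ F, ‖e‖ = 1 ∧ 0 ≤ T e e e ∧
      ∀ v ∈ F, inner ℝ e v = 0 → T e e v = 0 ∧ 2 * T e v v ≤ T e e e * ‖v‖ ^ 2 := by
  obtain ⟨e, heF, he1, hmax⟩ :=
    F.exists_norm_eq_one_forall_le hF T.continuous_apply_apply_apply_self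
  have hpos : 0 ≤ T e e e := by
    have := hmax (-e) (F.neg_mem heF) (by simpa using he1)
    simp only [map_neg, LinearMap.neg_apply] at this
    linarith
  have hmax' : ∀ x ∈ F, T x x x ≤ T e e e * ‖x‖ ^ 3 := by
    intro x hx
    rcases eq_or_ne x 0 with rfl | hx0
    · simp
    have hn : 0 < ‖x‖ := norm_pos_iff.2 hx0
    have := hmax (‖x‖⁻¹ • x) (F.smul_mem _ hx) (by simp [norm_smul, hx0])
    simp only [map_smul, LinearMap.smul_apply, smul_eq_mul] at this
    calc T x x x = (‖x‖⁻¹ * (‖x‖⁻¹ * (‖x‖⁻¹ * T x x x))) * ‖x‖ ^ 3 := by field_simp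
      _ ≤ _ := by gcongr
  refine ⟨e, heF, he1, hpos, fun v hv hev => ?_⟩
  -- The coefficients are those of the cubic at `e + t • v` minus `T e e e * (1 + t²‖v‖²) * (1 +
  -- t²‖v‖² / 2)`, whose constant term vanishes.
  have := eq_zero_and_nonpos_of_quartic_nonpos (a := 3 * T e e v)
    (b := 3 * T e v v - T e e e * (3 / 2 * ‖v‖ ^ 2)) (c := T v v v)
    (d := -(T e e e * (‖v‖ ^ 4 / 2))) fun t => ?_
  · exact ⟨by linarith [this.1], by linarith [this.2]⟩
  have h := hmax' (e + t • v) (F.add_mem heF (F.smul_mem t hv))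
  have hsq : ‖e + t • v‖ ^ 2 = 1 + t ^ 2 * ‖v‖ ^ 2 := by
    rw [norm_add_sq_real, inner_smul_right, hev, he1, norm_smul, mul_pow, Real.norm_eq_abs, sq_abs]
    ring
  -- The cube of the norm is not polynomial in `t`; `√(1 + u) ≤ 1 + u / 2` replaces it by a
  -- polynomial bound that is exact to second order.
  have hle : ‖e + t • v‖ ≤ 1 + t ^ 2 * ‖v‖ ^ 2 / 2 := by
    nlinarith [sq_nonneg (‖e + t • v‖ - 1)]
  have hcube : ‖e + t • v‖ ^ 3 ≤ (1 + t ^ 2 * ‖v‖ ^ 2) * (1 + t ^ 2 * ‖v‖ ^ 2 / 2) := by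
    calc ‖e + t • v‖ ^ 3 = ‖e + t • v‖ ^ 2 * ‖e + t • v‖ := by ring
      _ ≤ ‖e + t • v‖ ^ 2 * (1 + t ^ 2 * ‖v‖ ^ 2 / 2) := by gcongr
      _ = _ := by rw [hsq]
  have h' := h.trans (mul_le_mul_of_nonneg_left hcube hpos)
  have a1 : T e v e = T e e v := h2 _ _ _
  have a2 : T v e e = T e e v := by rw [h1, h2]
  have a3 : T v e v = T e v v := h1 _ _ _
  have a4 : T v v e = T e v v := by rw [h2, h1]
  simp only [map_add, LinearMap.add_apply, map_smul, LinearMap.smul_apply, smul_eq_mul,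
    a1, a2, a3, a4] at h'
  nlinarith

/-- Three vectors cannot span a four-dimensional space. Repeating a vector covers the cases of one
or two constraints. -/
theorem exists_ne_bot_orthogonal_triple (hE : Module.finrank ℝ E = 4) (a b c : E) :
    ∃ F : Submodule ℝ E, F ≠ ⊥ ∧
      ∀ x, x ∈ F ↔ inner ℝ a x = 0 ∧ inner ℝ b x = 0 ∧ inner ℝ c x = 0 := by
  refine ⟨(Submodule.span ℝ (Set.range ![a, b, c]))ᗮ, ?_, fun x => ?_⟩
  · intro h
    rw [Submodule.orthogonal_eq_bot_iff] at h
    have := finrank_range_le_card (R := ℝ) ![a, b, c]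
    rw [Set.finrank, h, finrank_top, hE] at this
    simp at this
  · rw [Submodule.mem_orthogonal']
    constructor
    · intro h
      refine ⟨?_, ?_, ?_⟩ <;> rw [real_inner_comm] <;>
        refine h _ (Submodule.subset_span ?_)
      exacts [⟨0, rfl⟩, ⟨1, rfl⟩, ⟨2, rfl⟩]
    · rintro ⟨ha, hb, hc⟩ u hu
      induction hu using Submodule.span_induction with
      | mem u hu =>
        obtain ⟨i, rfl⟩ := hu
        rw [real_inner_comm]
        fin_cases i <;> assumption
      | zero => simp
      | add u v _ _ hu hv => rw [inner_add_right, hu, hv, add_zero]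
      | smul r u _ hu => rw [inner_smul_right, hu, mul_zero]

end Maximum

theorem exists_orthonormalBasis_of_four {E : Type*} [NormedAddCommGroup E] [InnerProductSpace ℝ E]
    (hE : Module.finrank ℝ E = 4) {e f g h : E}
    (he : ‖e‖ = 1) (hf : ‖f‖ = 1) (hg : ‖g‖ = 1) (hh : ‖h‖ = 1) (hef : inner ℝ e f = 0)
    (heg : inner ℝ e g = 0) (heh : inner ℝ e h = 0) (hfg : inner ℝ f g = 0)
    (hfh : inner ℝ f h = 0) (hgh : inner ℝ g h = 0) :
    ∃ b : OrthonormalBasis (Fin 4) ℝ E, b 0 = e ∧ b 1 = f ∧ b 2 = g ∧ b 3 = h := by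
  have ho : Orthonormal ℝ ![e, f, g, h] := by
    constructor
    · intro i; fin_cases i <;> assumption
    · intro i j hij
      fin_cases i <;> fin_cases j <;>
        first
        | exact absurd rfl hij
        | assumption
        | (rw [real_inner_comm]; assumption)
  have hc : Fintype.card (Fin 4) = Module.finrank ℝ E := by simp [hE]
  let b := (basisOfOrthonormalOfCardEqFinrank ho hc).toOrthonormalBasis (by simpa using ho)
  have hb : ⇑b = ![e, f, g, h] := by simp [b]
  exact ⟨b, by rw [hb]; rfl, by rw [hb]; rfl, by rw [hb]; rfl, by rw [hb]; rfl⟩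

/-! ### The algebraic system for the eigenvalues of the Hessian -/

/-- A vector orthogonal to the independent vectors `(l₁, l₂, l₃)` and `(1, 1, 1)` is a multiple of
their cross product. -/
theorem exists_eq_mul_cross {l₁ l₂ l₃ a b c : ℝ} (h : ¬(l₁ = l₂ ∧ l₂ = l₃)) (h1 : a + b + c = 0)
    (h2 : l₁ * a + l₂ * b + l₃ * c = 0) :
    ∃ t, a = t * (l₂ - l₃) ∧ b = t * (l₃ - l₁) ∧ c = t * (l₁ - l₂) := by
  by_cases h23 : l₂ = l₃
  · have h12 : l₁ - l₂ ≠ 0 := fun h12 => h ⟨by linarith, h23⟩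
    refine ⟨c / (l₁ - l₂), ?_, ?_, by field_simp⟩ <;> field_simp <;> subst h23
    · linear_combination h2 - l₂ * h1
    · linear_combination l₁ * h1 - h2
  · have h23' : l₂ - l₃ ≠ 0 := sub_ne_zero.2 h23
    refine ⟨a / (l₂ - l₃), by field_simp, ?_, ?_⟩ <;> field_simp
    · linear_combination h2 - l₃ * h1
    · linear_combination l₂ * h1 - h2

/-- The equations on the eigenvalues `l₁, l₂, l₃` and the coefficients `t₁, t₂, t₃, s` of a cubic
form `c` in three variables with `c_{i11} = tᵢ (l₂ - l₃)`, `c_{i22} = tᵢ (l₃ - l₁)`,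
`c_{i33} = tᵢ (l₁ - l₂)`, `c_{123} = s`. -/
structure EigenvalueSystem (m l₁ l₂ l₃ t₁ t₂ t₃ s : ℝ) : Prop where
  pos : 0 < m
  trace : m + l₁ + l₂ + l₃ = 0
  le₁ : l₁ ≤ m / 2
  le₂ : l₂ ≤ m / 2
  le₃ : l₃ ≤ m / 2
  off₁₂ : (l₁ - l₂) * (t₁ * t₂ * (l₁ - l₂) - s * t₃) = 0
  off₂₃ : (l₂ - l₃) * (t₂ * t₃ * (l₂ - l₃) - s * t₁) = 0
  off₃₁ : (l₃ - l₁) * (t₃ * t₁ * (l₃ - l₁) - s * t₂) = 0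
  diag₁ : t₁ ^ 2 * ((l₂ - l₃) ^ 2 + (l₃ - l₁) ^ 2 + (l₁ - l₂) ^ 2) +
    2 * (t₂ ^ 2 * (l₂ - l₃) ^ 2 + t₃ ^ 2 * (l₂ - l₃) ^ 2 + s ^ 2) =
      m ^ 2 - l₁ ^ 2 + l₂ ^ 2 + l₃ ^ 2
  diag₂ : t₂ ^ 2 * ((l₂ - l₃) ^ 2 + (l₃ - l₁) ^ 2 + (l₁ - l₂) ^ 2) +
    2 * (t₃ ^ 2 * (l₃ - l₁) ^ 2 + t₁ ^ 2 * (l₃ - l₁) ^ 2 + s ^ 2) =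
      m ^ 2 + l₁ ^ 2 - l₂ ^ 2 + l₃ ^ 2
  diag₃ : t₃ ^ 2 * ((l₂ - l₃) ^ 2 + (l₃ - l₁) ^ 2 + (l₁ - l₂) ^ 2) +
    2 * (t₁ ^ 2 * (l₁ - l₂) ^ 2 + t₂ ^ 2 * (l₁ - l₂) ^ 2 + s ^ 2) =
      m ^ 2 + l₁ ^ 2 + l₂ ^ 2 - l₃ ^ 2

namespace EigenvalueSystem

theorem rotate {m l₁ l₂ l₃ t₁ t₂ t₃ s : ℝ} (h : EigenvalueSystem m l₁ l₂ l₃ t₁ t₂ t₃ s) :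
    EigenvalueSystem m l₂ l₃ l₁ t₂ t₃ t₁ s where
  pos := h.pos
  trace := by linarith [h.trace]
  le₁ := h.le₂
  le₂ := h.le₃
  le₃ := h.le₁
  off₁₂ := h.off₂₃
  off₂₃ := h.off₃₁
  off₃₁ := h.off₁₂
  diag₁ := by linarith [h.diag₂]
  diag₂ := by linarith [h.diag₃]
  diag₃ := by linarith [h.diag₁]

/-- The off-diagonal equations make `s` and `t₃` vanish unless `t₁ = t₂ = 0`. In the exceptional
case the diagonal equations give `l₃ = -l₁ = m`; in the other they leave, besides `l₁ = 0`, the root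
`l₃ = 3 * m`. The bound `l₃ ≤ m / 2` from maximality excludes both. -/
theorem of_eq {m l₁ l₂ l₃ t₁ t₂ t₃ s : ℝ} (h : EigenvalueSystem m l₁ l₂ l₃ t₁ t₂ t₃ s)
    (h12 : l₁ = l₂) (h23 : l₂ ≠ l₃) : l₁ = 0 ∧ l₂ = 0 ∧ t₃ = 0 ∧ s = 0 := by
  subst h12
  have hd : l₁ - l₃ ≠ 0 := sub_ne_zero.2 h23
  have hd' : l₃ - l₁ ≠ 0 := sub_ne_zero.2 h23.symm
  have e1 : t₂ * t₃ * (l₁ - l₃) - s * t₁ = 0 := (mul_eq_zero.1 h.off₂₃).resolve_left hd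
  have e2 : t₃ * t₁ * (l₃ - l₁) - s * t₂ = 0 := (mul_eq_zero.1 h.off₃₁).resolve_left hd'
  have hm : m = -(2 * l₁ + l₃) := by linarith [h.trace]
  have hp := h.pos
  have l1 := h.le₁
  have l3 := h.le₃
  have g1 := h.diag₁
  have g3 := h.diag₃
  have f1 : s * (t₁ ^ 2 + t₂ ^ 2) = 0 := by linear_combination (-t₁) * e1 - t₂ * e2
  have f2 : t₃ * (t₁ ^ 2 + t₂ ^ 2) = 0 := by
    have : (l₁ - l₃) * (t₃ * (t₁ ^ 2 + t₂ ^ 2)) = 0 := by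
      linear_combination t₂ * e1 - t₁ * e2
    exact (mul_eq_zero.1 this).resolve_left hd
  by_cases ht : t₁ ^ 2 + t₂ ^ 2 = 0
  · exfalso
    have ht1 : t₁ = 0 := by nlinarith
    have ht2 : t₂ = 0 := by nlinarith
    subst ht1 ht2
    have : (l₁ - l₃) * (l₁ + l₃) = 0 := by linarith
    have := (mul_eq_zero.1 this).resolve_left hd
    linarith
  · have hs : s = 0 := (mul_eq_zero.1 f1).resolve_right ht
    have ht3 : t₃ = 0 := (mul_eq_zero.1 f2).resolve_right ht
    subst hs ht3 hm
    have : l₁ * (6 * l₁ + 4 * l₃) = 0 := by linarith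
    rcases mul_eq_zero.1 this with h0 | h0
    · exact ⟨h0, h0, rfl, rfl⟩
    · exfalso; linarith

/-- Only `t₁ ^ 2` is left besides the eigenvalues. Eliminating it gives a product of three linear
factors, and each factor forces two eigenvalues to coincide. -/
theorem not_distinct_of_eq_zero {m l₁ l₂ l₃ t₁ t₂ t₃ s : ℝ}
    (h : EigenvalueSystem m l₁ l₂ l₃ t₁ t₂ t₃ s) (h12 : l₁ ≠ l₂) (h23 : l₂ ≠ l₃) (h31 : l₃ ≠ l₁)
    (ht2 : t₂ = 0) (ht3 : t₃ = 0) (hs : s = 0) : False := by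
  subst ht2 ht3 hs
  have g1 := h.diag₁
  have g2 := h.diag₂
  have g3 := h.diag₃
  have hm : m = -(l₁ + l₂ + l₃) := by linarith [h.trace]
  subst hm
  have k1 : t₁ ^ 2 * (l₂ + l₃ - 2 * l₁) = l₂ + l₃ := by
    have : (l₂ - l₃) * (t₁ ^ 2 * (l₂ + l₃ - 2 * l₁) - (l₂ + l₃)) = 0 := by linarith
    have := (mul_eq_zero.1 this).resolve_left (sub_ne_zero.2 h23)
    linarith
  have k2 : t₁ ^ 2 * (l₂ - l₃) ^ 2 = l₂ ^ 2 + l₃ ^ 2 - 2 * l₁ ^ 2 := by linarith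
  have k3 : (l₂ - l₃) ^ 2 = (l₂ + l₃) ^ 2 + 12 * l₁ * (l₂ + l₃) + 12 * l₁ ^ 2 := by
    linear_combination 2 * (g2 + g3) - 2 * k2 - 2 * (l₂ + l₃ - 2 * l₁) * k1
  -- Elimination of `t₁ ^ 2` between `k1` and `k2`; with `k3` the resulting cubic factors.
  have k4 : l₁ * ((2 * (l₂ + l₃) + l₁) * (l₂ + l₃ + 2 * l₁)) = 0 := by
    have : (l₂ + l₃) * (l₂ - l₃) ^ 2 = (l₂ + l₃ - 2 * l₁) * (l₂ ^ 2 + l₃ ^ 2 - 2 * l₁ ^ 2) := by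
      linear_combination (l₂ + l₃ - 2 * l₁) * k2 - (l₂ - l₃) ^ 2 * k1
    linear_combination this / 4 - ((l₂ + l₃) / 8 + l₁ / 4) * k3
  rcases mul_eq_zero.1 k4 with h0 | h0
  · subst h0
    have : l₂ * l₃ = 0 := by linarith
    rcases mul_eq_zero.1 this with h0 | h0
    · exact h12 h0.symm
    · exact h31 h0
  · rcases mul_eq_zero.1 h0 with h0 | h0
    · have hl : l₁ = -2 * (l₂ + l₃) := by linarith
      subst hl
      have : (2 * l₂ + 3 * l₃) * (3 * l₂ + 2 * l₃) = 0 := by linarith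
      rcases mul_eq_zero.1 this with h0 | h0
      · exact h31 (by linarith)
      · exact h12 (by linarith)
    · have hl : l₂ = -2 * l₁ - l₃ := by linarith
      subst hl
      have : (l₁ + l₃) ^ 2 + 2 * l₁ ^ 2 = 0 := by linarith
      have h1 : l₁ = 0 := by nlinarith [sq_nonneg (l₁ + l₃)]
      subst h1
      have h3 : l₃ = 0 := by nlinarith
      exact h31 h3

/-- For distinct eigenvalues the off-diagonal equations give `s * (t₁² + t₂² + t₃²) = 0`. If `s =
0`, all products `tᵢ tⱼ` vanish, so at most one `tᵢ` survives. If all `tᵢ` vanish, the diagonal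
equations make the squares of the eigenvalues equal, which three distinct reals cannot satisfy. So
two eigenvalues coincide, and `of_eq` applies. -/
theorem classification {m l₁ l₂ l₃ t₁ t₂ t₃ s : ℝ}
    (h : EigenvalueSystem m l₁ l₂ l₃ t₁ t₂ t₃ s) (hne : ¬(l₁ = l₂ ∧ l₂ = l₃)) :
    (l₁ = 0 ∧ l₂ = 0 ∧ t₃ = 0 ∧ s = 0) ∨ (l₂ = 0 ∧ l₃ = 0 ∧ t₁ = 0 ∧ s = 0) ∨
      (l₃ = 0 ∧ l₁ = 0 ∧ t₂ = 0 ∧ s = 0) := by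
  by_cases h12 : l₁ = l₂
  · exact .inl (h.of_eq h12 fun h23 => hne ⟨h12, h23⟩)
  by_cases h23 : l₂ = l₃
  · exact .inr (.inl (h.rotate.of_eq h23 fun h31 => h12 (h31.symm.trans h23.symm)))
  by_cases h31 : l₃ = l₁
  · exact .inr (.inr (h.rotate.rotate.of_eq h31 h12))
  exfalso
  have e1 := (mul_eq_zero.1 h.off₁₂).resolve_left (sub_ne_zero.2 h12)
  have e2 := (mul_eq_zero.1 h.off₂₃).resolve_left (sub_ne_zero.2 h23)
  have e3 := (mul_eq_zero.1 h.off₃₁).resolve_left (sub_ne_zero.2 h31)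
  have key : s * (t₁ ^ 2 + t₂ ^ 2 + t₃ ^ 2) = 0 := by
    linear_combination (-t₃) * e1 - t₁ * e2 - t₂ * e3
  rcases mul_eq_zero.1 key with hs | ht
  · subst hs
    have d12 : t₁ * t₂ = 0 := by
      have : t₁ * t₂ * (l₁ - l₂) = 0 := by linarith
      exact (mul_eq_zero.1 this).resolve_right (sub_ne_zero.2 h12)
    have d23 : t₂ * t₃ = 0 := by
      have : t₂ * t₃ * (l₂ - l₃) = 0 := by linarith
      exact (mul_eq_zero.1 this).resolve_right (sub_ne_zero.2 h23)
    have d31 : t₃ * t₁ = 0 := by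
      have : t₃ * t₁ * (l₃ - l₁) = 0 := by linarith
      exact (mul_eq_zero.1 this).resolve_right (sub_ne_zero.2 h31)
    rcases mul_eq_zero.1 d12 with h1 | h2
    · rcases mul_eq_zero.1 d23 with h2 | h3
      · exact h.rotate.rotate.not_distinct_of_eq_zero h31 h12 h23 h1 h2 rfl
      · exact h.rotate.not_distinct_of_eq_zero h23 h31 h12 h3 h1 rfl
    · rcases mul_eq_zero.1 d31 with h3 | h1
      · exact h.not_distinct_of_eq_zero h12 h23 h31 h2 h3 rfl
      · exact h.rotate.rotate.not_distinct_of_eq_zero h31 h12 h23 h1 h2 rfl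
  · have h1 : t₁ = 0 := by nlinarith [sq_nonneg t₁, sq_nonneg t₂, sq_nonneg t₃]
    have h2 : t₂ = 0 := by nlinarith [sq_nonneg t₁, sq_nonneg t₂, sq_nonneg t₃]
    have h3 : t₃ = 0 := by nlinarith [sq_nonneg t₁, sq_nonneg t₂, sq_nonneg t₃]
    have g1 := h.diag₁
    have g2 := h.diag₂
    have g3 := h.diag₃
    subst h1 h2 h3
    have a1 : (l₁ - l₂) * (l₁ + l₂) = 0 := by linarith
    have a2 : (l₂ - l₃) * (l₂ + l₃) = 0 := by linarith
    have a1' := (mul_eq_zero.1 a1).resolve_left (sub_ne_zero.2 h12)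
    have a2' := (mul_eq_zero.1 a2).resolve_left (sub_ne_zero.2 h23)
    exact h31 (by linarith)

end EigenvalueSystem

/-! ### Normal form and uniqueness of indecomposable solutions -/

theorem IsPolarForm.orthogonallyDecomposable {P : MvPolynomial (Fin 4) ℝ}
    {T : EuclideanSpace ℝ (Fin 4) →ₗ[ℝ] EuclideanSpace ℝ (Fin 4) →ₗ[ℝ]
      EuclideanSpace ℝ (Fin 4) →ₗ[ℝ] ℝ} (hs : IsPolarForm P T)
    (b : OrthonormalBasis (Fin 4) ℝ (EuclideanSpace ℝ (Fin 4))) (S : Set (Fin 4))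
    (hS : S.Nonempty) (hS' : Sᶜ.Nonempty)
    (hT : ∀ i ∈ S, ∀ j ∉ S, ∀ k, T (b i) (b j) (b k) = 0) : OrthogonallyDecomposable P := by
  have hne : ∀ S : Set (Fin 4), S.Nonempty → Submodule.span ℝ (b '' S) ≠ ⊥ := by
    rintro S ⟨i, hi⟩ h
    rw [Submodule.span_eq_bot] at h
    exact b.orthonormal.ne_zero i (h _ ⟨i, hi, rfl⟩)
  have horth : Submodule.span ℝ (b '' S) ⟂ Submodule.span ℝ (b '' Sᶜ) := by
    rw [Submodule.isOrtho_span]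
    rintro _ ⟨i, hi, rfl⟩ _ ⟨j, hj, rfl⟩
    exact b.inner_eq_zero fun h => hj (h ▸ hi)
  refine ⟨_, _, hne S hS, hne Sᶜ hS', ⟨horth.disjoint, ?_⟩, horth, ?_⟩
  · rw [codisjoint_iff, ← Submodule.span_union, ← Set.image_union, Set.union_compl_self,
      Set.image_univ, ← b.coe_toBasis]
    exact b.toBasis.span_eq
  · have h1 : ∀ i ∈ S, ∀ j ∉ S, T (b i) (b j) = 0 := fun i hi j hj =>
      b.toBasis.ext fun k => by simpa using hT i hi j hj k
    have h2 : ∀ i ∈ S, ∀ w ∈ Submodule.span ℝ (b '' Sᶜ), T (b i) w = 0 := by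
      intro i hi w hw
      have : Submodule.span ℝ (b '' Sᶜ) ≤ LinearMap.ker (T (b i)) := by
        rw [Submodule.span_le]
        rintro _ ⟨j, hj, rfl⟩
        exact h1 i hi j hj
      exact this hw
    have h3 : ∀ v ∈ Submodule.span ℝ (b '' S), ∀ w ∈ Submodule.span ℝ (b '' Sᶜ), T v w = 0 := by
      intro v hv w hw
      have : Submodule.span ℝ (b '' S) ≤ LinearMap.ker (T.flip w) := by
        rw [Submodule.span_le]
        rintro _ ⟨i, hi, rfl⟩
        exact h2 i hi w hw
      exact this hv
    intro v hv w hw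
    have e1 := hs.diag (v + w)
    have e2 := hs.diag v
    have e3 := hs.diag w
    have h0 := h3 v hv w hw
    have a1 : T v w v = 0 := by rw [h0]; rfl
    have a2 : T v w w = 0 := by rw [h0]; rfl
    have a3 : T w v v = 0 := by rw [hs.swap_left, a1]
    have a4 : T v v w = 0 := by rw [hs.swap_right, a1]
    have a5 : T w v w = 0 := by rw [hs.swap_left, a2]
    have a6 : T w w v = 0 := by rw [hs.swap_right, a5]
    simp only [map_add, LinearMap.add_apply, a1, a2, a3, a4, a5, a6] at e1
    linarith

/-- An orthonormal basis in which the first vector is a maximum point of `T` on the unit sphere and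
which diagonalizes the corresponding Hessian. -/
theorem IsPolarForm.exists_diagonalizing_basis {P : MvPolynomial (Fin 4) ℝ}
    {T : EuclideanSpace ℝ (Fin 4) →ₗ[ℝ] EuclideanSpace ℝ (Fin 4) →ₗ[ℝ]
      EuclideanSpace ℝ (Fin 4) →ₗ[ℝ] ℝ} (hs : IsPolarForm P T) :
    ∃ b : OrthonormalBasis (Fin 4) ℝ (EuclideanSpace ℝ (Fin 4)),
      0 ≤ T (b 0) (b 0) (b 0) ∧
      (∀ i, i ≠ 0 → T (b 0) (b 0) (b i) = 0 ∧ T (b 0) (b i) (b i) ≤ T (b 0) (b 0) (b 0) / 2) ∧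
      T (b 0) (b 1) (b 2) = 0 ∧ T (b 0) (b 1) (b 3) = 0 ∧ T (b 0) (b 2) (b 3) = 0 := by
  have hE : Module.finrank ℝ (EuclideanSpace ℝ (Fin 4)) = 4 := by simp
  obtain ⟨e, -, he, he0, hemax⟩ := Submodule.exists_norm_eq_one_cubic_max
    (F := (⊤ : Submodule ℝ (EuclideanSpace ℝ (Fin 4)))) top_ne_bot T hs.swap_left hs.swap_right
  obtain ⟨F₁, hF₁, hF₁'⟩ := exists_ne_bot_orthogonal_triple hE e e e
  obtain ⟨f, hf, hf1, hfF⟩ :=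
    Submodule.exists_norm_eq_one_forall_orthogonal hF₁ (T e) (hs.swap_right e)
  obtain ⟨F₂, hF₂, hF₂'⟩ := exists_ne_bot_orthogonal_triple hE e f f
  obtain ⟨g, hg, hg1, hgF⟩ :=
    Submodule.exists_norm_eq_one_forall_orthogonal hF₂ (T e) (hs.swap_right e)
  obtain ⟨F₃, hF₃, hF₃'⟩ := exists_ne_bot_orthogonal_triple hE e f g
  obtain ⟨h, hh, hh1, -⟩ :=
    Submodule.exists_norm_eq_one_forall_orthogonal hF₃ (T e) (hs.swap_right e)
  obtain ⟨hef, -, -⟩ := (hF₁' f).1 hf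
  obtain ⟨heg, hfg, -⟩ := (hF₂' g).1 hg
  obtain ⟨heh, hfh, hgh⟩ := (hF₃' h).1 hh
  obtain ⟨b, b0, b1, b2, b3⟩ :=
    exists_orthonormalBasis_of_four hE he hf1 hg1 hh1 hef heg heh hfg hfh hgh
  refine ⟨b, by rwa [b0], fun i hi => ?_, ?_, ?_, ?_⟩
  · have h0 : inner ℝ (b 0) (b i) = 0 := b.inner_eq_zero hi.symm
    rw [b0] at h0 ⊢
    obtain ⟨h1, h2⟩ := hemax (b i) trivial h0
    rw [b.norm_eq_one] at h2
    exact ⟨h1, by linarith⟩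
  · rw [b0, b1, b2]
    exact hfF g ((hF₁' g).2 ⟨heg, heg, heg⟩) hfg
  · rw [b0, b1, b3]
    exact hfF h ((hF₁' h).2 ⟨heh, heh, heh⟩) hfh
  · rw [b0, b2, b3]
    exact hgF h ((hF₂' h).2 ⟨heh, hfh, hfh⟩) hgh

/-- The alternative for the coefficients of a solution of the system in an orthonormal basis as in
`IsPolarForm.exists_diagonalizing_basis`. -/
theorem scalar_or_split_of_tensor {κ : ℝ} (hκ : 0 < κ) (c : Fin 4 → Fin 4 → Fin 4 → ℝ)
    (s1 : ∀ i j k, c i j k = c j i k) (s2 : ∀ i j k, c i j k = c i k j)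
    (hm : 0 ≤ c 0 0 0) (hb : ∀ i, i ≠ 0 → c 0 0 i = 0 ∧ c 0 i i ≤ c 0 0 0 / 2)
    (z12 : c 0 1 2 = 0) (z13 : c 0 1 3 = 0) (z23 : c 0 2 3 = 0)
    (htr : ∀ a, ∑ i, c a i i = 0)
    (hK : ∀ a b, ∑ i, ∑ j, c a i j * c b i j = if a = b then κ else 0) :
    (c 0 0 0 = √(3 * κ / 4) ∧ ∀ i, i ≠ 0 → c 0 i i = -√(3 * κ / 4) / 3) ∨
      ∃ a, a ≠ 0 ∧ ∀ i j k, (i = 0 ∨ i = a) → j ≠ 0 → j ≠ a → c i j k = 0 := by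
  obtain ⟨z1, le1⟩ := hb 1 (by decide)
  obtain ⟨z2, le2⟩ := hb 2 (by decide)
  obtain ⟨z3, le3⟩ := hb 3 (by decide)
  have tr0 := htr 0
  have tr1 := htr 1
  have tr2 := htr 2
  have tr3 := htr 3
  have k00 := hK 0 0
  have k01 := hK 0 1
  have k02 := hK 0 2
  have k03 := hK 0 3
  have k11 := hK 1 1
  have k22 := hK 2 2
  have k33 := hK 3 3
  have k12 := hK 1 2
  have k13 := hK 1 3
  have k23 := hK 2 3
  clear hK htr
  simp only [Fin.sum_univ_four, if_true, Fin.reduceEq, if_false,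
    s1 1 0, s1 2 0, s1 3 0, s1 2 1, s1 3 1, s1 3 2,
    s2 _ 1 0, s2 _ 2 0, s2 _ 3 0, s2 _ 2 1, s2 _ 3 1, s2 _ 3 2,
    z1, z2, z3, z12, z13, z23] at tr0 tr1 tr2 tr3 k00 k01 k02 k03 k11 k22 k33 k12 k13 k23
  -- If the maximum were zero, the eigenvalues would be nonpositive with sum zero, hence zero,
  -- contradicting `κ > 0` in `k00`.
  have hmpos : 0 < c 0 0 0 := by
    rcases hm.eq_or_lt with hm0 | hm0
    · rw [← hm0] at le1 le2 le3 tr0 k00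
      have e1 : c 0 1 1 = 0 := by linarith
      have e2 : c 0 2 2 = 0 := by linarith
      have e3 : c 0 3 3 = 0 := by linarith
      rw [e1, e2, e3] at k00
      linarith
    · exact hm0
  by_cases hne : c 0 1 1 = c 0 2 2 ∧ c 0 2 2 = c 0 3 3
  · left
    obtain ⟨h12, h23⟩ := hne
    have l1 : c 0 1 1 = -c 0 0 0 / 3 := by linarith
    have l2 : c 0 2 2 = -c 0 0 0 / 3 := by linarith
    have l3 : c 0 3 3 = -c 0 0 0 / 3 := by linarith
    have hμ : c 0 0 0 = √(3 * κ / 4) := by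
      rw [eq_comm, Real.sqrt_eq_iff_mul_self_eq (by positivity) hm]
      rw [l1, l2, l3] at k00
      linarith
    rw [← hμ]
    refine ⟨rfl, fun i hi => ?_⟩
    fin_cases i
    exacts [absurd rfl hi, l1, l2, l3]
  right
  -- For each `i ≠ 0`, the diagonal `(c i 1 1, c i 2 2, c i 3 3)` is orthogonal to `(1, 1, 1)` by
  -- the trace condition and to the eigenvalues by the vanishing Frobenius product of slices `0` and
  -- `i`.
  obtain ⟨t₁, p11, p12, p13⟩ := exists_eq_mul_cross hne (a := c 1 1 1)
    (b := c 1 2 2) (c := c 1 3 3) (by linarith) (by linarith)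
  obtain ⟨t₂, p21, p22, p23⟩ := exists_eq_mul_cross hne (a := c 1 1 2)
    (b := c 2 2 2) (c := c 2 3 3) (by linarith) (by linarith)
  obtain ⟨t₃, p31, p32, p33⟩ := exists_eq_mul_cross hne (a := c 1 1 3)
    (b := c 2 2 3) (c := c 3 3 3) (by linarith) (by linarith)
  rw [p11, p12, p13, p21, p22, p23, p31, p32] at k12
  rw [p11, p12, p13, p21, p23, p31, p32, p33] at k13
  rw [p12, p13, p21, p22, p23, p31, p32, p33] at k23
  rw [p11, p12, p13, p21, p31] at k11
  rw [p12, p21, p22, p23, p32] at k22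
  rw [p13, p23, p31, p32, p33] at k33
  -- Subtracting `k00` eliminates `κ` from the diagonal equations.
  have sys : EigenvalueSystem (c 0 0 0) (c 0 1 1) (c 0 2 2) (c 0 3 3) t₁ t₂ t₃ (c 1 2 3) :=
    { pos := hmpos
      trace := by linarith
      le₁ := le1
      le₂ := le2
      le₃ := le3
      off₁₂ := by linear_combination k12 / 2
      off₂₃ := by linear_combination k23 / 2
      off₃₁ := by linear_combination k13 / 2
      diag₁ := by linear_combination k11 - k00
      diag₂ := by linear_combination k22 - k00
      diag₃ := by linear_combination k33 - k00 }
  -- The index `a` of the remaining eigenvalue joins `0`; the other two indices, with eigenvalue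
  -- zero, span the complementary plane.
  rcases sys.classification hne with ⟨l1, l2, t0, s0⟩ | ⟨l1, l2, t0, s0⟩ | ⟨l1, l2, t0, s0⟩
  · refine ⟨3, by decide, fun i j k hi hj0 hja => ?_⟩
    rw [t0] at p31 p32 p33
    rw [l1, l2] at p13 p23
    have hj : j = 1 ∨ j = 2 := by revert j; decide
    rcases hi with rfl | rfl <;> rcases hj with rfl | rfl <;> fin_cases k <;>
    simp only [Fin.mk_zero', Fin.mk_one, Fin.reduceFinMk, Fin.zero_eta, Fin.isValue,
    s1 1 0, s1 2 0, s1 3 0, s1 2 1, s1 3 1, s1 3 2,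
    s2 _ 1 0, s2 _ 2 0, s2 _ 3 0, s2 _ 2 1, s2 _ 3 1, s2 _ 3 2,
      z1, z2, z3, z12, z13, z23, p13, p23, p31, p32, l1, l2, s0,
      zero_mul, sub_self, mul_zero]
  · refine ⟨1, by decide, fun i j k hi hj0 hja => ?_⟩
    rw [t0] at p11 p12 p13
    rw [l1, l2] at p21 p31
    have hj : j = 2 ∨ j = 3 := by revert j; decide
    rcases hi with rfl | rfl <;> rcases hj with rfl | rfl <;> fin_cases k <;>
    simp only [Fin.mk_zero', Fin.mk_one, Fin.reduceFinMk, Fin.zero_eta, Fin.isValue,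
    s1 1 0, s1 2 0, s1 3 0, s1 2 1, s1 3 1, s1 3 2,
    s2 _ 1 0, s2 _ 2 0, s2 _ 3 0, s2 _ 2 1, s2 _ 3 1, s2 _ 3 2,
      z1, z2, z3, z12, z13, z23, p12, p13, p21, p31, l1, l2, s0,
      zero_mul, sub_self, mul_zero]
  · refine ⟨2, by decide, fun i j k hi hj0 hja => ?_⟩
    rw [t0] at p21 p22 p23
    rw [l1, l2] at p12 p32
    have hj : j = 1 ∨ j = 3 := by revert j; decide
    rcases hi with rfl | rfl <;> rcases hj with rfl | rfl <;> fin_cases k <;>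
    simp only [Fin.mk_zero', Fin.mk_one, Fin.reduceFinMk, Fin.zero_eta, Fin.isValue,
    s1 1 0, s1 2 0, s1 3 0, s1 2 1, s1 3 1, s1 3 2,
    s2 _ 1 0, s2 _ 2 0, s2 _ 3 0, s2 _ 2 1, s2 _ 3 1, s2 _ 3 2,
      z1, z2, z3, z12, z13, z23, p12, p21, p23, p32, l1, l2, s0,
      zero_mul, sub_self, mul_zero]

/-- For an indecomposable solution, the Hessian at the maximum point is scalar on the orthogonal
complement. -/
theorem SolvesSystem.exists_scalar_hessian {κ : ℝ} (hκ : 0 < κ) {P : MvPolynomial (Fin 4) ℝ}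
    {T : EuclideanSpace ℝ (Fin 4) →ₗ[ℝ] EuclideanSpace ℝ (Fin 4) →ₗ[ℝ]
      EuclideanSpace ℝ (Fin 4) →ₗ[ℝ] ℝ} (hs : IsPolarForm P T)
    (hT : ∀ i j x, MvPolynomial.eval (fun k => x k)
      (MvPolynomial.pderiv i (MvPolynomial.pderiv j P)) =
      T (EuclideanSpace.single i 1) (EuclideanSpace.single j 1) x)
    (h : SolvesSystem κ P) (hind : ¬ OrthogonallyDecomposable P) :
    ∃ e, ‖e‖ = 1 ∧ T e e e = √(3 * κ / 4) ∧
      (∀ x, inner ℝ e x = 0 → T e e x = 0) ∧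
      ∀ x y, inner ℝ e x = 0 → inner ℝ e y = 0 →
        T e x y = -√(3 * κ / 4) / 3 * inner ℝ x y := by
  obtain ⟨b, hm, hb, z12, z13, z23⟩ := hs.exists_diagonalizing_basis
  obtain ⟨htr, hK⟩ := h.sum_polarForm hs hT b
  obtain ⟨hμ, hl⟩ | ⟨a, ha, hz⟩ := scalar_or_split_of_tensor hκ (fun i j k => T (b i) (b j) (b k))
    (fun i j k => hs.swap_left _ _ _) (fun i j k => hs.swap_right _ _ _) hm hb z12 z13 z23
    (fun a => htr (b a)) (fun i j => by
      rw [hK, b.inner_eq_ite, mul_ite, mul_one, mul_zero])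
  swap
  · refine absurd (hs.orthogonallyDecomposable b {0, a} ⟨0, by simp⟩ ?_ ?_) hind
    · by_cases ha1 : a = 1
      · exact ⟨2, by simp [ha1]⟩
      · exact ⟨1, by simpa using fun h => ha1 h.symm⟩
    · intro i hi j hj k
      simp only [Set.mem_insert_iff, Set.mem_singleton_iff, not_or] at hi hj
      exact hz i j k hi hj.1 hj.2
  have z1 := (hb 1 (by decide)).1
  have z2 := (hb 2 (by decide)).1
  have z3 := (hb 3 (by decide)).1
  have l1 := hl 1 (by decide)
  have l2 := hl 2 (by decide)
  have l3 := hl 3 (by decide)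
  refine ⟨b 0, b.norm_eq_one 0, hμ, fun x hx => ?_, fun x y hx hy => ?_⟩
  · rw [← b.sum_repr' x]
    simp only [Fin.sum_univ_four, map_add, map_smul, smul_eq_mul, hx, z1, z2, z3]
    ring
  · have hxy := b.sum_inner_mul_inner x y
    rw [← hxy]
    conv_lhs => rw [← b.sum_repr' x, ← b.sum_repr' y]
    simp only [Fin.sum_univ_four, map_add, map_smul, smul_eq_mul, hx, hy, z1, z2, z3,
      LinearMap.add_apply, LinearMap.smul_apply, z12, z13, z23,
      hs.swap_right _ (b 1) (b 0), hs.swap_right _ (b 2) (b 0), hs.swap_right _ (b 3) (b 0),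
      hs.swap_right _ (b 2) (b 1), hs.swap_right _ (b 3) (b 1), hs.swap_right _ (b 3) (b 2)]
    rw [l1, l2, l3, real_inner_comm (b 0) x, real_inner_comm (b 1) x, real_inner_comm (b 2) x,
      real_inner_comm (b 3) x, hx]
    ring

/-- The coefficients of an indecomposable solution in a basis of successive maximum points. -/
theorem normalForm_of_tensor {κ : ℝ} (hκ : 0 < κ) (c : Fin 4 → Fin 4 → Fin 4 → ℝ)
    (s1 : ∀ i j k, c i j k = c j i k) (s2 : ∀ i j k, c i j k = c i k j)
    (z1 : c 0 0 1 = 0) (z2 : c 0 0 2 = 0) (z3 : c 0 0 3 = 0)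
    (z12 : c 0 1 2 = 0) (z13 : c 0 1 3 = 0) (z23 : c 0 2 3 = 0)
    (l1 : c 0 1 1 = -√(3 * κ / 4) / 3) (l2 : c 0 2 2 = -√(3 * κ / 4) / 3)
    (l3 : c 0 3 3 = -√(3 * κ / 4) / 3)
    (f1 : 0 ≤ c 1 1 1) (f2 : c 1 1 2 = 0) (f3 : c 1 1 3 = 0)
    (m2 : 2 * c 1 2 2 ≤ c 1 1 1) (m3 : 2 * c 1 3 3 ≤ c 1 1 1)
    (mp : c 1 2 2 + c 1 3 3 + 2 * c 1 2 3 ≤ c 1 1 1)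
    (mn : c 1 2 2 + c 1 3 3 - 2 * c 1 2 3 ≤ c 1 1 1)
    (g2 : 0 ≤ c 2 2 2) (g3 : c 2 2 3 = 0)
    (htr : ∀ a, ∑ i, c a i i = 0)
    (hK : ∀ a b, ∑ i, ∑ j, c a i j * c b i j = if a = b then κ else 0) :
    c 1 1 1 = √(5 * κ / 9) ∧ c 1 2 2 = -√(5 * κ / 9) / 2 ∧ c 1 3 3 = -√(5 * κ / 9) / 2 ∧
      c 1 2 3 = 0 ∧ c 2 2 2 = √(5 * κ / 18) ∧ c 2 3 3 = -√(5 * κ / 18) ∧ c 3 3 3 = 0 := by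
  have tr1 := htr 1
  have tr2 := htr 2
  have tr3 := htr 3
  have k11 := hK 1 1
  have k22 := hK 2 2
  have k33 := hK 3 3
  have k23 := hK 2 3
  have hsq : √(3 * κ / 4) * √(3 * κ / 4) = 3 * κ / 4 := Real.mul_self_sqrt (by positivity)
  clear hK htr
  simp only [Fin.sum_univ_four, if_true, Fin.reduceEq, if_false,
    s1 1 0, s1 2 0, s1 3 0, s1 2 1, s1 3 1, s1 3 2,
    s2 _ 1 0, s2 _ 2 0, s2 _ 3 0, s2 _ 2 1, s2 _ 3 1, s2 _ 3 2,
    z1, z2, z3, z12, z13, z23, f2, f3, g3] at tr1 tr2 tr3 k11 k22 k33 k23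
  have p3 : c 2 3 3 = -c 2 2 2 := by linarith
  have q3 : c 3 3 3 = 0 := by linarith
  rw [p3] at k22 k33
  rw [l1] at k11
  rw [l2] at k22
  rw [l3] at k33
  rw [q3] at k33 k23
  -- If the maximum on the complement of the first vector were zero, the second-order conditions in
  -- the directions of the last two basis vectors and of their sum and difference would kill `c 1 2
  -- 2`, `c 1 3 3` and `c 1 2 3`. Then `k11` would read `κ / 6 = κ`.
  have hν : c 1 1 1 ≠ 0 := by
    intro hν
    rw [hν] at m2 m3 mp mn tr1 k11
    have e2 : c 1 2 2 = 0 := by linarith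
    have e3 : c 1 3 3 = 0 := by linarith
    have e23 : c 1 2 3 = 0 := by linarith
    rw [e2, e3, e23] at k11
    linarith
  have hγ : c 1 2 3 = 0 := by
    have : c 1 1 1 * c 1 2 3 = 0 := by
      linear_combination c 1 2 3 * tr1 - k23 / 2
    exact (mul_eq_zero.1 this).resolve_left hν
  rw [hγ] at k11 k22 k33
  have hαβ : c 1 2 2 = c 1 3 3 := by
    have : c 1 1 1 * (c 1 2 2 - c 1 3 3) = 0 := by
      linear_combination (c 1 2 2 - c 1 3 3) * tr1 - (k22 - k33) / 2
    exact sub_eq_zero.1 ((mul_eq_zero.1 this).resolve_left hν)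
  have hα : c 1 2 2 = -c 1 1 1 / 2 := by linarith
  have hβ : c 1 3 3 = -c 1 1 1 / 2 := by linarith
  rw [hα, hβ] at k11
  rw [hα] at k22
  have hν' : c 1 1 1 = √(5 * κ / 9) := by
    rw [eq_comm, Real.sqrt_eq_iff_mul_self_eq (by positivity) f1]
    linarith
  have hp : c 2 2 2 = √(5 * κ / 18) := by
    rw [eq_comm, Real.sqrt_eq_iff_mul_self_eq (by positivity) g2]
    linarith
  rw [hν'] at hα hβ
  rw [hp] at p3
  exact ⟨hν', hα, hβ, hγ, hp, p3, q3⟩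

/-- Every indecomposable solution takes the same form in a suitable orthonormal basis. -/
theorem SolvesSystem.exists_normalForm {κ : ℝ} (hκ : 0 < κ) {P : MvPolynomial (Fin 4) ℝ}
    (hP : P.IsHomogeneous 3) (h : SolvesSystem κ P) (hind : ¬ OrthogonallyDecomposable P) :
    ∃ b : OrthonormalBasis (Fin 4) ℝ (EuclideanSpace ℝ (Fin 4)), ∀ x : Fin 4 → ℝ,
      6 * polyFun P (∑ i, x i • b i) =
        √(3 * κ / 4) * (x 0 ^ 3 - x 0 * (x 1 ^ 2 + x 2 ^ 2 + x 3 ^ 2)) +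
        √(5 * κ / 9) * (x 1 ^ 3 - 3 / 2 * x 1 * (x 2 ^ 2 + x 3 ^ 2)) +
        √(5 * κ / 18) * (x 2 ^ 3 - 3 * x 2 * x 3 ^ 2) := by
  obtain ⟨T, hs, hT⟩ := hP.exists_isPolarForm
  obtain ⟨e, he, he0, he1, he2⟩ := h.exists_scalar_hessian hκ hs hT hind
  have hE : Module.finrank ℝ (EuclideanSpace ℝ (Fin 4)) = 4 := by simp
  obtain ⟨F₁, hF₁, hF₁'⟩ := exists_ne_bot_orthogonal_triple hE e e e
  obtain ⟨f, hf, hf1, hf0, hfF⟩ :=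
    Submodule.exists_norm_eq_one_cubic_max hF₁ T hs.swap_left hs.swap_right
  obtain ⟨F₂, hF₂, hF₂'⟩ := exists_ne_bot_orthogonal_triple hE e f f
  obtain ⟨g, hg, hg1, hg0, hgF⟩ :=
    Submodule.exists_norm_eq_one_cubic_max hF₂ T hs.swap_left hs.swap_right
  obtain ⟨F₃, hF₃, hF₃'⟩ := exists_ne_bot_orthogonal_triple hE e f g
  obtain ⟨h', hh, hh1, -⟩ :=
    Submodule.exists_norm_eq_one_cubic_max hF₃ T hs.swap_left hs.swap_right
  obtain ⟨hef, -, -⟩ := (hF₁' f).1 hf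
  obtain ⟨heg, hfg, -⟩ := (hF₂' g).1 hg
  obtain ⟨heh, hfh, hgh⟩ := (hF₃' h').1 hh
  obtain ⟨b, b0, b1, b2, b3⟩ :=
    exists_orthonormalBasis_of_four hE he hf1 hg1 hh1 hef heg heh hfg hfh hgh
  have hF₁'' : ∀ v, inner ℝ e v = 0 → v ∈ F₁ := fun v hv => (hF₁' v).2 ⟨hv, hv, hv⟩
  have hgF₁ := hfF g (hF₁'' g heg) hfg
  have hhF₁ := hfF h' (hF₁'' h' heh) hfh
  have hp := (hfF (g + h') (hF₁'' _ (by rw [inner_add_right, heg, heh, add_zero]))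
    (by rw [inner_add_right, hfg, hfh, add_zero])).2
  have hn := (hfF (g - h') (hF₁'' _ (by rw [inner_sub_right, heg, heh, sub_zero]))
    (by rw [inner_sub_right, hfg, hfh, sub_zero])).2
  have hhF₂ := hgF h' ((hF₂' h').2 ⟨heh, hfh, hfh⟩) hgh
  rw [norm_add_sq_real, hg1, hh1, hgh] at hp
  rw [norm_sub_sq_real, hg1, hh1, hgh] at hn
  have hsgh := hs.swap_right f h' g
  simp only [map_add, LinearMap.add_apply, hsgh] at hp
  simp only [map_sub, LinearMap.sub_apply, hsgh] at hn
  obtain ⟨htr, hK⟩ := h.sum_polarForm hs hT b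
  have key := normalForm_of_tensor hκ (fun i j k => T (b i) (b j) (b k))
    (fun i j k => hs.swap_left _ _ _) (fun i j k => hs.swap_right _ _ _)
  simp only [b0, b1, b2, b3] at key
  obtain ⟨c111, c122, c133, c123, c222, c233, c333⟩ := key (he1 f hef) (he1 g heg)
    (he1 h' heh) (by rw [he2 _ _ hef heg, hfg, mul_zero]) (by rw [he2 _ _ hef heh, hfh, mul_zero])
    (by rw [he2 _ _ heg heh, hgh, mul_zero])
    (by rw [he2 _ _ hef hef, real_inner_self_eq_norm_sq, hf1]; ring)
    (by rw [he2 _ _ heg heg, real_inner_self_eq_norm_sq, hg1]; ring)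
    (by rw [he2 _ _ heh heh, real_inner_self_eq_norm_sq, hh1]; ring)
    hf0 hgF₁.1 hhF₁.1 (by have := hgF₁.2; rw [hg1] at this; linarith)
    (by have := hhF₁.2; rw [hh1] at this; linarith) (by linarith) (by linarith) hg0 hhF₂.1
    (fun a => htr (b a)) (fun i j => by
      rw [hK, b.inner_eq_ite, mul_ite, mul_one, mul_zero])
  have c012 : T e f g = 0 := by rw [he2 _ _ hef heg, hfg, mul_zero]
  have c013 : T e f h' = 0 := by rw [he2 _ _ hef heh, hfh, mul_zero]
  have c023 : T e g h' = 0 := by rw [he2 _ _ heg heh, hgh, mul_zero]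
  have c011 : T e f f = -√(3 * κ / 4) / 3 := by
    rw [he2 _ _ hef hef, real_inner_self_eq_norm_sq, hf1]; ring
  have c022 : T e g g = -√(3 * κ / 4) / 3 := by
    rw [he2 _ _ heg heg, real_inner_self_eq_norm_sq, hg1]; ring
  have c033 : T e h' h' = -√(3 * κ / 4) / 3 := by
    rw [he2 _ _ heh heh, real_inner_self_eq_norm_sq, hh1]; ring
  refine ⟨b, fun x => ?_⟩
  rw [← hs.diag, Fin.sum_univ_four, b0, b1, b2, b3]
  simp only [map_add, LinearMap.add_apply, map_smul, LinearMap.smul_apply, smul_eq_mul,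
    hs.swap_left f e, hs.swap_left g e, hs.swap_left h' e, hs.swap_left g f, hs.swap_left h' f,
    hs.swap_left h' g, hs.swap_right _ f e, hs.swap_right _ g e, hs.swap_right _ h' e,
    hs.swap_right _ g f, hs.swap_right _ h' f, hs.swap_right _ h' g,
    he0, he1 f hef, he1 g heg, he1 h' heh, c012, c013, c023, c011, c022, c033, c111, c122, c133,
    c123, c222, c233, c333, hgF₁.1, hhF₁.1, hhF₂.1]
  ring

/-- Any two indecomposable solutions are orthogonally equivalent. -/
theorem SolvesSystem.orthogonallyEquivalent {κ : ℝ} (hκ : 0 < κ) {P Q : MvPolynomial (Fin 4) ℝ}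
    (hP : P.IsHomogeneous 3) (hQ : Q.IsHomogeneous 3) (h : SolvesSystem κ P)
    (hind : ¬ OrthogonallyDecomposable P) (h' : SolvesSystem κ Q)
    (hind' : ¬ OrthogonallyDecomposable Q) : OrthogonallyEquivalent P Q := by
  obtain ⟨b, hb⟩ := h.exists_normalForm hκ hP hind
  obtain ⟨b', hb'⟩ := h'.exists_normalForm hκ hQ hind'
  -- The isometry matching the two adapted bases carries one normal form to the other.
  refine ⟨b'.equiv b (Equiv.refl _), ?_⟩
  funext x
  have e1 := hb (fun i => b.repr x i)
  have e2 := hb' (fun i => b.repr x i)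
  rw [← e2, b.sum_repr] at e1
  have hx : (b'.equiv b (Equiv.refl _)).toLinearEquiv⁻¹ x = ∑ i, b.repr x i • b' i := by
    have : x = (b'.equiv b (Equiv.refl _)).toLinearEquiv (∑ i, b.repr x i • b' i) := by
      rw [map_sum]
      simp [b.sum_repr]
    conv_lhs => rw [this]
    exact (b'.equiv b (Equiv.refl _)).toLinearEquiv.symm_apply_apply _
  rw [linAct, hx]
  linarith

/-! ### The regular simplex and sums of cubes -/

/-- With `i, j` vertices and `a, b` coordinates, this turns the squared norm of the Hessian into an
expression in the squares of the Gram matrix entries. -/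
theorem sum_sum_mul_sum_mul_sum {α β R : Type*} [Fintype α] [Fintype β] [CommSemiring R]
    (y : α → α → R) (q : α → α → β → R) :
    ∑ a, ∑ b, ∑ i, ∑ j, y i j * (q i j a * q i j b) =
      ∑ i, ∑ j, y i j * ((∑ a, q i j a) * ∑ a, q i j a) := by
  calc _ = ∑ a, ∑ i, ∑ b, ∑ j, y i j * (q i j a * q i j b) :=
        Finset.sum_congr rfl fun a _ => Finset.sum_comm
    _ = ∑ i, ∑ a, ∑ b, ∑ j, y i j * (q i j a * q i j b) := Finset.sum_comm
    _ = ∑ i, ∑ a, ∑ j, ∑ b, y i j * (q i j a * q i j b) :=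
        Finset.sum_congr rfl fun i _ => Finset.sum_congr rfl fun a _ => Finset.sum_comm
    _ = ∑ i, ∑ j, ∑ a, ∑ b, y i j * (q i j a * q i j b) :=
        Finset.sum_congr rfl fun i _ => Finset.sum_comm
    _ = _ := by simp only [Finset.sum_mul_sum]; simp only [Finset.mul_sum]

/-- The unit vectors from the barycentre to the vertices of a regular simplex in `ℝ⁴`. -/
structure IsSimplexFrame (w : Fin 5 → EuclideanSpace ℝ (Fin 4)) : Prop where
  inner_eq : ∀ i j, inner ℝ (w i) (w j) = if i = j then (1 : ℝ) else -1 / 4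
  sum_inner_smul : ∀ x, ∑ i, (inner ℝ (w i) x : ℝ) • w i = (5 / 4 : ℝ) • x

/-- The unit vectors towards the vertices of the regular simplex of `simplicialForm`. -/
def standardSimplex : Fin 5 → EuclideanSpace ℝ (Fin 4) :=
  ![!₂[0, 0, 0, 1], !₂[√5 / 4, -√5 / 4, -√5 / 4, -1 / 4], !₂[-√5 / 4, √5 / 4, -√5 / 4, -1 / 4],
    !₂[-√5 / 4, -√5 / 4, √5 / 4, -1 / 4], !₂[√5 / 4, √5 / 4, √5 / 4, -1 / 4]]

theorem isSimplexFrame_standardSimplex : IsSimplexFrame standardSimplex := by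
  have h5 : √5 * √5 = 5 := Real.mul_self_sqrt (by norm_num)
  constructor
  · intro i j
    rw [PiLp.inner_apply, Fin.sum_univ_four]
    have habs : |√5| = √5 := abs_of_nonneg (Real.sqrt_nonneg 5)
    fin_cases i <;> fin_cases j <;> simp [standardSimplex, habs] <;> linarith
  · intro x
    ext k
    fin_cases k <;>
      simp [standardSimplex, PiLp.inner_apply, Fin.sum_univ_four, Fin.sum_univ_five] <;>
      ring_nf <;> simp <;> ring

/-- The factor `16 / 15` normalises the coefficient of `x₄³`, which in the sum of cubes is `1 - 4 /
64 = 15 / 16`. -/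
theorem polyFun_simplicialForm (κ : ℝ) (x : EuclideanSpace ℝ (Fin 4)) :
    polyFun (simplicialForm κ) x =
      (√(3 * κ) / 12 * (16 / 15)) * ∑ i, inner ℝ (standardSimplex i) x ^ 3 := by
  have h5 : √5 ^ 3 = 5 * √5 := by
    rw [pow_succ, Real.sq_sqrt (by norm_num)]
  simp [polyFun, simplicialForm, standardSimplex, PiLp.inner_apply, Fin.sum_univ_four,
    Fin.sum_univ_five]
  ring_nf
  simp [h5]
  ring

theorem isHomogeneous_simplicialForm (κ : ℝ) : (simplicialForm κ).IsHomogeneous 3 := by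
  have hX : ∀ i : Fin 4, (MvPolynomial.X i : MvPolynomial (Fin 4) ℝ).IsHomogeneous 1 :=
    MvPolynomial.isHomogeneous_X ℝ
  have hX2 : ∀ i : Fin 4, (MvPolynomial.X i ^ 2 : MvPolynomial (Fin 4) ℝ).IsHomogeneous 2 :=
    fun i => (hX i).pow 2
  refine MvPolynomial.IsHomogeneous.C_mul ?_ _
  refine MvPolynomial.IsHomogeneous.add (.sub ((hX 3).pow 3) ?_) (.C_mul ?_ _)
  · exact (hX 3).mul (((hX2 0).add (hX2 1)).add (hX2 2))
  · exact ((hX 0).mul (hX 1)).mul (hX 2)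

/-- A cubic form on `ℝ⁴` which is `K ∑ ⟨wᵢ, x⟩³` for the vertices `wᵢ` of a regular simplex. -/
structure IsSimplicialWith (P : MvPolynomial (Fin 4) ℝ) (K : ℝ)
    (w : Fin 5 → EuclideanSpace ℝ (Fin 4)) : Prop extends IsSimplexFrame w where
  ne_zero : K ≠ 0
  polyFun_eq : ∀ x, polyFun P x = K * ∑ i, inner ℝ (w i) x ^ 3

theorem OrthogonallyEquivalent.isSimplicialWith {κ : ℝ} (hκ : 0 < κ) {P : MvPolynomial (Fin 4) ℝ}
    (h : OrthogonallyEquivalent P (simplicialForm κ)) :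
    ∃ w, IsSimplicialWith P (√(3 * κ) / 12 * (16 / 15)) w := by
  obtain ⟨g, hg⟩ := h
  have hinner : ∀ i x, inner ℝ (g (standardSimplex i)) x =
      inner ℝ (standardSimplex i) (g.symm x) := by
    intro i x
    conv_lhs => rw [← g.apply_symm_apply x]
    exact g.inner_map_map _ _
  have hst := isSimplexFrame_standardSimplex
  refine ⟨fun i => g (standardSimplex i), ⟨fun i j => ?_, fun x => ?_⟩, by positivity, fun x => ?_⟩
  · rw [g.inner_map_map, hst.inner_eq]
  · have := congrArg g (hst.sum_inner_smul (g.symm x))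
    simpa [hinner, map_sum] using this
  · rw [hg]
    simp only [hinner]
    exact polyFun_simplicialForm κ (g.symm x)

namespace IsSimplexFrame

variable {w : Fin 5 → EuclideanSpace ℝ (Fin 4)}

theorem sum_eq_zero (h : IsSimplexFrame w) : ∑ i, w i = 0 := by
  rw [← inner_self_eq_zero (𝕜 := ℝ)]
  simp only [sum_inner, inner_sum, h.inner_eq]
  simp [Fin.sum_univ_five]
  norm_num

theorem sum_inner_eq_zero (h : IsSimplexFrame w) (x : EuclideanSpace ℝ (Fin 4)) :
    ∑ i, inner ℝ (w i) x = 0 := by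
  rw [← sum_inner, h.sum_eq_zero, inner_zero_left]

theorem sum_inner_mul_inner (h : IsSimplexFrame w) (x y : EuclideanSpace ℝ (Fin 4)) :
    ∑ i, inner ℝ (w i) x * inner ℝ (w i) y = 5 / 4 * inner ℝ x y := by
  have := congrArg (fun z => inner ℝ z y) (h.sum_inner_smul x)
  simpa [sum_inner, inner_smul_left] using this

theorem eq_of_inner_eq (h : IsSimplexFrame w) {x y : EuclideanSpace ℝ (Fin 4)}
    (hxy : ∀ i, inner ℝ (w i) x = inner ℝ (w i) y) : x = y := by
  have h1 := h.sum_inner_smul x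
  simp only [hxy] at h1
  rw [h.sum_inner_smul y] at h1
  exact (smul_right_injective _ (by norm_num : (5 / 4 : ℝ) ≠ 0) h1).symm

end IsSimplexFrame

namespace IsSimplicialWith

variable {P : MvPolynomial (Fin 4) ℝ} {K : ℝ} {w : Fin 5 → EuclideanSpace ℝ (Fin 4)}

theorem polarForm_eq (h : IsSimplicialWith P K w)
    {T : EuclideanSpace ℝ (Fin 4) →ₗ[ℝ] EuclideanSpace ℝ (Fin 4) →ₗ[ℝ]
      EuclideanSpace ℝ (Fin 4) →ₗ[ℝ] ℝ} (hs : IsPolarForm P T) (x y z) :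
    T x y z = 6 * K * ∑ i, inner ℝ (w i) x * inner ℝ (w i) y * inner ℝ (w i) z := by
  rw [hs.apply_eq]
  simp only [h.polyFun_eq, inner_add_right, Fin.sum_univ_five]
  ring

/-- The Laplacian is a multiple of `∑ ⟨wᵢ, x⟩ = 0`. The squared Gram entries are `1` and `1 / 16`,
that is `15 / 16` times the identity plus a constant matrix, which contributes nothing for the same
reason. With the frame constant this gives `36 · (15 / 16) · (5 / 4) = 675 / 16`. -/
theorem solvesSystem (h : IsSimplicialWith P K w) (hP : P.IsHomogeneous 3) {κ : ℝ}
    (hK : K ^ 2 * (675 / 16) = κ) : SolvesSystem κ P := by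
  obtain ⟨T, hs, hT⟩ := hP.exists_isPolarForm
  rw [solvesSystem_iff hT]
  have hb : ∀ i j, ∑ a, inner ℝ (w i) (EuclideanSpace.single a (1 : ℝ)) *
      inner ℝ (w j) (EuclideanSpace.single a (1 : ℝ)) = inner ℝ (w i) (w j) := by
    intro i j
    rw [← (EuclideanSpace.basisFun (Fin 4) ℝ).sum_inner_mul_inner]
    refine Finset.sum_congr rfl fun a _ => ?_
    rw [EuclideanSpace.basisFun_apply, real_inner_comm (w j)]
  constructor
  · intro x
    simp only [h.polarForm_eq hs]
    rw [← Finset.mul_sum, Finset.sum_comm]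
    simp only [← Finset.sum_mul, hb, h.inner_eq, if_true, one_mul, h.sum_inner_eq_zero, mul_zero]
  · intro x
    have e : ∀ a b, T (EuclideanSpace.single a 1) (EuclideanSpace.single b 1) x ^ 2 =
        36 * K ^ 2 * ∑ i, ∑ j, inner ℝ (w i) x * inner ℝ (w j) x *
          ((inner ℝ (w i) (EuclideanSpace.single a (1 : ℝ)) *
            inner ℝ (w j) (EuclideanSpace.single a (1 : ℝ))) *
          (inner ℝ (w i) (EuclideanSpace.single b (1 : ℝ)) *
            inner ℝ (w j) (EuclideanSpace.single b (1 : ℝ)))) := by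
      intro a b
      rw [h.polarForm_eq hs, mul_pow, sq (∑ i, _), Finset.sum_mul_sum]
      congr 1
      · ring
      · exact Finset.sum_congr rfl fun i _ => Finset.sum_congr rfl fun j _ => by ring
    have e2 : ∑ a, ∑ b, T (EuclideanSpace.single a 1) (EuclideanSpace.single b 1) x ^ 2 =
        36 * K ^ 2 * ∑ i, ∑ j, inner ℝ (w i) x * inner ℝ (w j) x *
          (inner ℝ (w i) (w j) * inner ℝ (w i) (w j)) := by
      simp only [e, ← Finset.mul_sum]
      congr 1
      simp only [← hb]
      exact sum_sum_mul_sum_mul_sum _ _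
    rw [e2, ← hK]
    have h1 := h.sum_inner_eq_zero x
    have h2 := h.sum_inner_mul_inner x x
    rw [real_inner_self_eq_norm_sq] at h2
    simp only [h.inner_eq, Fin.sum_univ_five] at h1 h2 ⊢
    simp
    generalize inner ℝ (w 0) x = y0 at *
    generalize inner ℝ (w 1) x = y1 at *
    generalize inner ℝ (w 2) x = y2 at *
    generalize inner ℝ (w 3) x = y3 at *
    generalize inner ℝ (w 4) x = y4 at *
    linear_combination 36 * K ^ 2 * (15 / 16) * h2 +
      36 * K ^ 2 / 16 * (y0 + y1 + y2 + y3 + y4) * h1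

/-- A splitting forces vectors of `V` and `W` to have disjoint supports in the simplex coordinates.
Writing a vertex as `v + u` distributes its coordinates `1, -1/4, -1/4, -1/4, -1/4` between `v` and
`u`. Since the coordinates of `v` sum to zero, one part takes all. So the vertex lies in `V` or `W`,
and, as its coordinates are all nonzero, the other subspace is zero. -/
theorem not_orthogonallyDecomposable (h : IsSimplicialWith P K w) :
    ¬ OrthogonallyDecomposable P := by
  rintro ⟨V, W, hV, hW, hVW, hort, hsplit⟩
  have h1 : ∀ v ∈ V, ∀ u ∈ W, (∑ i, inner ℝ (w i) v ^ 2 * inner ℝ (w i) u = 0) ∧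
      ∑ i, inner ℝ (w i) v * inner ℝ (w i) u ^ 2 = 0 := by
    intro v hv u hu
    have e1 := hsplit v hv u hu
    have e2 := hsplit v hv (-u) (W.neg_mem hu)
    simp only [h.polyFun_eq, ← mul_add, inner_add_right, inner_neg_right] at e1 e2
    have e1' := mul_left_cancel₀ h.ne_zero e1
    have e2' := mul_left_cancel₀ h.ne_zero e2
    simp only [Fin.sum_univ_five] at e1' e2' ⊢
    constructor <;> linarith
  have h2 : ∀ v ∈ V, ∀ u ∈ W, ∀ z,
      ∑ i, inner ℝ (w i) v * inner ℝ (w i) u * inner ℝ (w i) z = 0 := by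
    intro v hv u hu z
    obtain ⟨v', hv', u', hu', rfl⟩ := Submodule.mem_sup.1 (hVW.sup_eq_top ▸ Submodule.mem_top (x := z))
    have a1 := (h1 (v + v') (V.add_mem hv hv') u hu).1
    have a2 := (h1 v hv u hu).1
    have a3 := (h1 v' hv' u hu).1
    have b1 := (h1 v hv (u + u') (W.add_mem hu hu')).2
    have b2 := (h1 v hv u hu).2
    have b3 := (h1 v hv u' hu').2
    simp only [Fin.sum_univ_five, inner_add_right] at *
    linarith
  -- Testing `h2` on `w i` gives `5 / 4` times this product minus a quarter of the sum of all the
  -- products; that sum is a multiple of `⟨v, u⟩ = 0`.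
  have h3 : ∀ v ∈ V, ∀ u ∈ W, ∀ i, inner ℝ (w i) v * inner ℝ (w i) u = 0 := by
    intro v hv u hu i
    have e1 := h2 v hv u hu (w i)
    have e2 := h.sum_inner_mul_inner v u
    rw [hort.inner_eq hv hu] at e2
    simp only [h.inner_eq, Fin.sum_univ_five] at e1 e2
    fin_cases i <;> simp [-mul_eq_zero] at e1 ⊢ <;> linarith
  obtain ⟨v, hv, u, hu, hvu⟩ :=
    Submodule.mem_sup.1 (hVW.sup_eq_top ▸ Submodule.mem_top (x := w 0))
  have hne : ∀ i, inner ℝ (w i) (w 0) ≠ 0 := by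
    intro i
    rw [h.inner_eq]
    split_ifs <;> norm_num
  have key : (∀ i, inner ℝ (w i) v = 0) ∨ ∀ i, inner ℝ (w i) u = 0 := by
    have s1 := h.sum_inner_eq_zero v
    have hadd : ∀ i, inner ℝ (w i) v + inner ℝ (w i) u = if i = 0 then (1 : ℝ) else -1 / 4 := by
      intro i
      rw [← inner_add_right, hvu, h.inner_eq]
    have hm := h3 v hv u hu
    simp only [Fin.forall_fin_succ, Fin.forall_fin_zero, Fin.sum_univ_five] at hadd hm s1 ⊢
    simp at hadd hm s1 ⊢
    obtain ⟨a0, a1, a2, a3, a4⟩ := hadd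
    obtain ⟨m0, m1, m2, m3, m4⟩ := hm
    generalize inner ℝ (w 0) v = p0 at *
    generalize inner ℝ (w 1) v = p1 at *
    generalize inner ℝ (w 2) v = p2 at *
    generalize inner ℝ (w 3) v = p3 at *
    generalize inner ℝ (w 4) v = p4 at *
    rcases m0 with m0 | m0
    · left
      rcases m1 with m1 | m1 <;> rcases m2 with m2 | m2 <;> rcases m3 with m3 | m3 <;>
        rcases m4 with m4 | m4 <;> first | exact ⟨m0, m1, m2, m3, m4⟩ | (exfalso; linarith)
    · right
      rcases m1 with m1 | m1 <;> rcases m2 with m2 | m2 <;> rcases m3 with m3 | m3 <;>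
        rcases m4 with m4 | m4 <;> first | exact ⟨m0, m1, m2, m3, m4⟩ | (exfalso; linarith)
  rcases key with hk | hk
  · have hv0 : v = 0 := h.eq_of_inner_eq fun i => by rw [hk, inner_zero_right]
    rw [hv0, zero_add] at hvu
    refine hV ((Submodule.eq_bot_iff _).2 fun v' hv' => h.eq_of_inner_eq fun i => ?_)
    rw [inner_zero_right]
    exact (mul_eq_zero.1 (h3 v' hv' u hu i)).resolve_right (hvu ▸ hne i)
  · have hu0 : u = 0 := h.eq_of_inner_eq fun i => by rw [hk, inner_zero_right]
    rw [hu0, add_zero] at hvu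
    refine hW ((Submodule.eq_bot_iff _).2 fun u' hu' => h.eq_of_inner_eq fun i => ?_)
    rw [inner_zero_right]
    exact (mul_eq_zero.1 (h3 v hv u' hu' i)).resolve_left (hvu ▸ hne i)

end IsSimplicialWith

/-! ### The automorphism group -/

theorem Fin.sum_eq_of_five_distinct {f : Fin 5 → ℝ} {a b c d e : Fin 5}
    (h : Function.Injective ![a, b, c, d, e]) : ∑ i, f i = f a + f b + f c + f d + f e := by
  rw [← (Finite.injective_iff_bijective.1 h).sum_comp, Fin.sum_univ_five]
  rfl

namespace IsSimplexFrame

variable {w : Fin 5 → EuclideanSpace ℝ (Fin 4)}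

/-- The edge vector of the simplex from the vertex `j` to the vertex `i` has the coordinates
`δᵢ - δⱼ`. -/
theorem inner_edge (h : IsSimplexFrame w) (i j k : Fin 5) :
    inner ℝ (w k) ((4 / 5 : ℝ) • (w i - w j)) =
      (if k = i then (1 : ℝ) else 0) - if k = j then 1 else 0 := by
  rw [inner_smul_right, inner_sub_right, h.inner_eq, h.inner_eq]
  split_ifs <;> norm_num

theorem exists_inner_ne_zero (h : IsSimplexFrame w) {x : EuclideanSpace ℝ (Fin 4)} (hx : x ≠ 0) :
    ∃ i, inner ℝ (w i) x ≠ 0 := by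
  by_contra! hc
  exact hx (h.eq_of_inner_eq fun i => by rw [hc, inner_zero_right])

/-- Testing on edge vectors: only constant vectors are orthogonal to all vectors of coordinate sum
zero. -/
theorem mul_eq_mul_of_sum_eq_zero (h : IsSimplexFrame w) {x y : EuclideanSpace ℝ (Fin 4)}
    (hxy : ∀ z, ∑ i, inner ℝ (w i) x * inner ℝ (w i) y * inner ℝ (w i) z = 0) (i j : Fin 5) :
    inner ℝ (w i) x * inner ℝ (w i) y = inner ℝ (w j) x * inner ℝ (w j) y := by
  have := hxy ((4 / 5 : ℝ) • (w i - w j))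
  simp only [h.inner_edge, mul_sub, Finset.sum_sub_distrib, mul_ite, mul_one, mul_zero,
    Finset.sum_ite_eq', Finset.mem_univ, if_true] at this
  linarith

/-- A vector annihilated, in the sense of the third derivative, by two independent vectors is
parallel to an edge of the simplex. -/
theorem exists_edge (h : IsSimplexFrame w) {u v v' : EuclideanSpace ℝ (Fin 4)} (hu : u ≠ 0)
    (hv : v ≠ 0) (hvv' : ∀ s : ℝ, v' ≠ s • v)
    (h1 : ∀ z, ∑ i, inner ℝ (w i) u * inner ℝ (w i) v * inner ℝ (w i) z = 0)
    (h2 : ∀ z, ∑ i, inner ℝ (w i) u * inner ℝ (w i) v' * inner ℝ (w i) z = 0) :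
    ∃ (a b : Fin 5) (t : ℝ), a ≠ b ∧ 0 < t ∧ ∀ k, inner ℝ (w k) u =
      t * ((if k = a then (1 : ℝ) else 0) - if k = b then 1 else 0) := by
  have e1 := h.mul_eq_mul_of_sum_eq_zero h1
  have e2 := h.mul_eq_mul_of_sum_eq_zero h2
  -- The products are constant in `i`. Were the constant nonzero, `u` would have no zero coordinate
  -- and would determine `v` and `v'` up to scale, against independence.
  have key : ∀ i, inner ℝ (w i) u * inner ℝ (w i) v = 0 := by
    by_contra! hc
    obtain ⟨i₀, hi₀⟩ := hc
    have hne : ∀ i, inner ℝ (w i) u ≠ 0 := fun i hi => hi₀ (by rw [← e1 i, hi, zero_mul])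
    have hpq : inner ℝ (w i₀) v ≠ 0 := right_ne_zero_of_mul hi₀
    refine hvv' (inner ℝ (w i₀) v' / inner ℝ (w i₀) v) (h.eq_of_inner_eq fun i => ?_)
    rw [inner_smul_right]
    field_simp
    refine mul_left_cancel₀ (mul_ne_zero (hne i) (hne i₀)) ?_
    linear_combination inner ℝ (w i₀) u * inner ℝ (w i₀) v * e2 i i₀ -
      inner ℝ (w i₀) u * inner ℝ (w i₀) v' * e1 i i₀
  have key' : ∀ i, inner ℝ (w i) u * inner ℝ (w i) v' = 0 := by
    obtain ⟨j, hj⟩ := h.exists_inner_ne_zero hv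
    intro i
    rw [e2 i j, (mul_eq_zero.1 (key j)).resolve_right hj, zero_mul]
  obtain ⟨a, ha⟩ := h.exists_inner_ne_zero hu
  have hsum := h.sum_inner_eq_zero u
  obtain ⟨b, hba, hb⟩ : ∃ b, b ≠ a ∧ inner ℝ (w b) u ≠ 0 := by
    by_contra! hc
    rw [Finset.sum_eq_single a (fun b _ hb => hc b hb) (by simp)] at hsum
    exact ha hsum
  -- A third nonzero coordinate of `u` would confine `v` and `v'` to the two remaining coordinates,
  -- where the vectors of sum zero form a line.
  have hother : ∀ c, c ≠ a → c ≠ b → inner ℝ (w c) u = 0 := by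
    intro c hca hcb
    by_contra hc
    have hz : ∀ x : EuclideanSpace ℝ (Fin 4), (∀ i, inner ℝ (w i) u * inner ℝ (w i) x = 0) →
        ∀ i j, i ≠ j → i ≠ a → i ≠ b → i ≠ c → j ≠ a → j ≠ b → j ≠ c →
          inner ℝ (w i) x + inner ℝ (w j) x = 0 := by
      intro x hx i j hij hia hib hic hja hjb hjc
      have hs := h.sum_inner_eq_zero x
      rw [Fin.sum_eq_of_five_distinct (a := a) (b := b) (c := c) (d := i) (e := j) ?_,
        (mul_eq_zero.1 (hx a)).resolve_left ha, (mul_eq_zero.1 (hx b)).resolve_left hb,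
        (mul_eq_zero.1 (hx c)).resolve_left hc] at hs
      · linarith
      · intro m n hmn
        fin_cases m <;> fin_cases n <;> simp_all [eq_comm]
    obtain ⟨i₀, hi₀⟩ := h.exists_inner_ne_zero hv
    refine hvv' (inner ℝ (w i₀) v' / inner ℝ (w i₀) v) (h.eq_of_inner_eq fun i => ?_)
    rw [inner_smul_right]
    field_simp
    have hnz : ∀ k, inner ℝ (w k) u ≠ 0 → inner ℝ (w k) v = 0 ∧ inner ℝ (w k) v' = 0 :=
      fun k hk => ⟨(mul_eq_zero.1 (key k)).resolve_left hk,
        (mul_eq_zero.1 (key' k)).resolve_left hk⟩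
    by_cases hi : inner ℝ (w i) u = 0
    · have hiu : inner ℝ (w i₀) u = 0 := (mul_eq_zero.1 (key i₀)).resolve_right hi₀
      by_cases hii : i = i₀
      · subst hii; ring
      · have hne : ∀ {k l : Fin 5}, inner ℝ (w k) u = 0 → inner ℝ (w l) u ≠ 0 → k ≠ l :=
          fun hk hl hkl => hl (hkl ▸ hk)
        have s1 := hz v key i i₀ hii (hne hi ha) (hne hi hb) (hne hi hc) (hne hiu ha) (hne hiu hb)
          (hne hiu hc)
        have s2 := hz v' key' i i₀ hii (hne hi ha) (hne hi hb) (hne hi hc) (hne hiu ha)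
          (hne hiu hb) (hne hiu hc)
        linear_combination inner ℝ (w i₀) v * s2 - inner ℝ (w i₀) v' * s1
    · rw [(hnz i hi).1, (hnz i hi).2]; ring
  have hab : inner ℝ (w a) u + inner ℝ (w b) u = 0 := by
    rw [← hsum, ← Finset.sum_pair (f := fun c => inner ℝ (w c) u) hba.symm]
    exact Finset.sum_subset (Finset.subset_univ _) fun c _ hc => by
      simp only [Finset.mem_insert, Finset.mem_singleton, not_or] at hc
      exact hother c hc.1 hc.2
  -- The edge is oriented so that the factor is positive.
  rcases lt_or_gt_of_ne ha with hneg | hpos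
  · refine ⟨b, a, -inner ℝ (w a) u, hba, by linarith, fun k => ?_⟩
    by_cases hka : k = a
    · subst hka; simp [hba.symm]
    by_cases hkb : k = b
    · subst hkb; simp [hka]; linarith
    · simp [hka, hkb, hother k hka hkb]
  · refine ⟨a, b, inner ℝ (w a) u, hba.symm, hpos, fun k => ?_⟩
    by_cases hka : k = a
    · subst hka; simp [hba.symm]
    by_cases hkb : k = b
    · subst hkb; simp [hka]; linarith
    · simp [hka, hkb, hother k hka hkb]

/-- The linear map permuting the vertices of the simplex. -/
def permMap (w : Fin 5 → EuclideanSpace ℝ (Fin 4)) (σ : Equiv.Perm (Fin 5)) :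
    EuclideanSpace ℝ (Fin 4) →ₗ[ℝ] EuclideanSpace ℝ (Fin 4) :=
  (4 / 5 : ℝ) • ∑ i, (innerₗ _ (w i)).smulRight (w (σ i))

theorem permMap_apply (σ : Equiv.Perm (Fin 5)) (x : EuclideanSpace ℝ (Fin 4)) :
    permMap w σ x = (4 / 5 : ℝ) • ∑ i, (inner ℝ (w i) x : ℝ) • w (σ i) := by
  simp [permMap, LinearMap.sum_apply]

theorem inner_permMap (h : IsSimplexFrame w) (σ : Equiv.Perm (Fin 5))
    (x : EuclideanSpace ℝ (Fin 4)) (k : Fin 5) :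
    inner ℝ (w k) (permMap w σ x) = inner ℝ (w (σ⁻¹ k)) x := by
  have h0 := h.sum_inner_eq_zero x
  have e : ∀ i, inner ℝ (w i) x * inner ℝ (w k) (w (σ i)) =
      5 / 4 * (if i = σ⁻¹ k then inner ℝ (w i) x else 0) - 1 / 4 * inner ℝ (w i) x := by
    intro i
    rw [h.inner_eq]
    by_cases hi : k = σ i
    · have : i = σ⁻¹ k := by rw [hi]; simp
      rw [if_pos hi, if_pos this]; ring
    · have : i ≠ σ⁻¹ k := fun h => hi (by rw [h]; simp)
      rw [if_neg hi, if_neg this]; ring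
  rw [permMap_apply, inner_smul_right, inner_sum]
  simp only [inner_smul_right, e, Finset.sum_sub_distrib, ← Finset.mul_sum, h0,
    Finset.sum_ite_eq', Finset.mem_univ, if_true]
  ring

theorem permMap_permMap (h : IsSimplexFrame w) (σ τ : Equiv.Perm (Fin 5))
    (x : EuclideanSpace ℝ (Fin 4)) : permMap w σ (permMap w τ x) = permMap w (σ * τ) x := by
  refine h.eq_of_inner_eq fun k => ?_
  rw [h.inner_permMap, h.inner_permMap, h.inner_permMap, mul_inv_rev, Equiv.Perm.mul_apply]

theorem permMap_one (h : IsSimplexFrame w) (x : EuclideanSpace ℝ (Fin 4)) :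
    permMap w 1 x = x := by
  refine h.eq_of_inner_eq fun k => ?_
  rw [h.inner_permMap]; simp

theorem permMap_vertex (h : IsSimplexFrame w) (σ : Equiv.Perm (Fin 5)) (i : Fin 5) :
    permMap w σ (w i) = w (σ i) := by
  refine h.eq_of_inner_eq fun k => ?_
  rw [h.inner_permMap, h.inner_eq, h.inner_eq]
  exact if_congr Equiv.Perm.inv_eq_iff_eq rfl rfl

theorem injective (h : IsSimplexFrame w) : Function.Injective w := by
  intro i j hij
  by_contra hne
  have h1 := h.inner_eq i i
  have h2 := h.inner_eq i j
  rw [← hij, if_neg hne] at h2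
  rw [if_pos rfl] at h1
  linarith

theorem norm_permMap (h : IsSimplexFrame w) (σ : Equiv.Perm (Fin 5))
    (x : EuclideanSpace ℝ (Fin 4)) : ‖permMap w σ x‖ = ‖x‖ := by
  have e1 := h.sum_inner_mul_inner x x
  have e2 := h.sum_inner_mul_inner (permMap w σ x) (permMap w σ x)
  simp only [h.inner_permMap] at e2
  rw [Equiv.sum_comp σ⁻¹ fun k => inner ℝ (w k) x * inner ℝ (w k) x, e1,
    real_inner_self_eq_norm_sq, real_inner_self_eq_norm_sq] at e2
  exact (sq_eq_sq₀ (norm_nonneg _) (norm_nonneg _)).1 (by linarith)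

/-- The symmetric group acting on `ℝ⁴` by permuting the vertices of the simplex. -/
def permEquiv (h : IsSimplexFrame w) :
    Equiv.Perm (Fin 5) →* (EuclideanSpace ℝ (Fin 4) ≃ₗ[ℝ] EuclideanSpace ℝ (Fin 4)) where
  toFun σ := LinearEquiv.ofLinearMap (permMap w σ) (permMap w σ⁻¹)
    (by ext1 x; simp [h.permMap_permMap, h.permMap_one])
    (by ext1 x; simp [h.permMap_permMap, h.permMap_one])
  map_one' := by ext1 x; exact h.permMap_one x
  map_mul' σ τ := by ext1 x; exact (h.permMap_permMap σ τ x).symm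

theorem permEquiv_apply (h : IsSimplexFrame w) (σ : Equiv.Perm (Fin 5))
    (x : EuclideanSpace ℝ (Fin 4)) : h.permEquiv σ x = permMap w σ x := rfl

theorem permEquiv_injective (h : IsSimplexFrame w) : Function.Injective h.permEquiv := by
  intro σ τ hστ
  ext1 i
  apply h.injective
  rw [← h.permMap_vertex, ← h.permMap_vertex, ← h.permEquiv_apply, hστ, h.permEquiv_apply]

end IsSimplexFrame

theorem six_mul_sum_mul_mul {ι : Type*} (s : Finset ι) (a b c : ι → ℝ) :
    6 * ∑ i ∈ s, a i * b i * c i = ∑ i ∈ s, (a i + b i + c i) ^ 3 - ∑ i ∈ s, (a i + b i) ^ 3 -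
      ∑ i ∈ s, (a i + c i) ^ 3 - ∑ i ∈ s, (b i + c i) ^ 3 + ∑ i ∈ s, a i ^ 3 +
      ∑ i ∈ s, b i ^ 3 + ∑ i ∈ s, c i ^ 3 := by
  simp only [Finset.mul_sum, ← Finset.sum_sub_distrib, ← Finset.sum_add_distrib]
  exact Finset.sum_congr rfl fun i _ => by ring

theorem Fin.exists_three_distinct {i j : Fin 5} (hij : i ≠ j) : ∃ k l m : Fin 5,
    k ≠ i ∧ k ≠ j ∧ l ≠ i ∧ l ≠ j ∧ m ≠ i ∧ m ≠ j ∧ k ≠ l ∧ k ≠ m ∧ l ≠ m := by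
  revert i j; decide

namespace IsSimplexFrame

variable {w : Fin 5 → EuclideanSpace ℝ (Fin 4)}
  {g : EuclideanSpace ℝ (Fin 4) ≃ₗ[ℝ] EuclideanSpace ℝ (Fin 4)}

theorem sum_map_mul_mul (hg : ∀ x, ∑ i, inner ℝ (w i) (g x) ^ 3 = ∑ i, inner ℝ (w i) x ^ 3)
    (x y z : EuclideanSpace ℝ (Fin 4)) :
    ∑ i, inner ℝ (w i) (g x) * inner ℝ (w i) (g y) * inner ℝ (w i) (g z) =
      ∑ i, inner ℝ (w i) x * inner ℝ (w i) y * inner ℝ (w i) z := by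
  have e1 := six_mul_sum_mul_mul Finset.univ (fun i => inner ℝ (w i) (g x))
    (fun i => inner ℝ (w i) (g y)) (fun i => inner ℝ (w i) (g z))
  have e2 := six_mul_sum_mul_mul Finset.univ (fun i => inner ℝ (w i) x)
    (fun i => inner ℝ (w i) y) (fun i => inner ℝ (w i) z)
  simp only [← inner_add_right, ← map_add, hg] at e1
  simp only [← inner_add_right] at e2
  linarith

theorem sum_edge_mul_edge (h : IsSimplexFrame w) {i j k l : Fin 5} (hki : k ≠ i) (hkj : k ≠ j)
    (hli : l ≠ i) (hlj : l ≠ j) (z : EuclideanSpace ℝ (Fin 4)) :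
    ∑ m, inner ℝ (w m) ((4 / 5 : ℝ) • (w i - w j)) * inner ℝ (w m) ((4 / 5 : ℝ) • (w k - w l)) *
      inner ℝ (w m) z = 0 := by
  refine Finset.sum_eq_zero fun m _ => ?_
  rw [h.inner_edge, h.inner_edge]
  by_cases h1 : m = i
  · subst h1; simp [hki.symm, hli.symm]
  by_cases h2 : m = j
  · subst h2; simp [hkj.symm, hlj.symm]
  simp [h1, h2]

theorem edge_ne_zero (h : IsSimplexFrame w) {i j : Fin 5} (hij : i ≠ j) :
    (4 / 5 : ℝ) • (w i - w j) ≠ 0 := by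
  intro h0
  have := h.inner_edge i j i
  rw [h0, inner_zero_right, if_pos rfl, if_neg hij] at this
  linarith

/-- The edge `ij` is annihilated by two independent edges among the other three vertices. Since `g`
preserves the trilinear form and independence, `exists_edge` applies to the image. -/
theorem exists_map_edge_eq_smul (h : IsSimplexFrame w)
    (hg : ∀ x, ∑ i, inner ℝ (w i) (g x) ^ 3 = ∑ i, inner ℝ (w i) x ^ 3) {i j : Fin 5}
    (hij : i ≠ j) :
    ∃ (a b : Fin 5) (t : ℝ), a ≠ b ∧ 0 < t ∧
      ∀ k, inner ℝ (w k) (g ((4 / 5 : ℝ) • (w i - w j))) =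
        t * ((if k = a then (1 : ℝ) else 0) - if k = b then 1 else 0) := by
  obtain ⟨k, l, m, hki, hkj, hli, hlj, hmi, hmj, hkl, hkm, hlm⟩ := Fin.exists_three_distinct hij
  refine h.exists_edge (v := g ((4 / 5 : ℝ) • (w k - w l))) (v' := g ((4 / 5 : ℝ) • (w k - w m)))
    (fun h0 => h.edge_ne_zero hij (g.map_eq_zero_iff.1 h0))
    (fun h0 => h.edge_ne_zero hkl (g.map_eq_zero_iff.1 h0)) (fun s hs => ?_) (fun z => ?_)
    (fun z => ?_)
  · rw [← map_smul] at hs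
    have h1 := congrArg (inner ℝ (w m)) (g.injective hs)
    rw [h.inner_edge, inner_smul_right, h.inner_edge, if_pos rfl, if_neg hkm.symm,
      if_neg hlm.symm] at h1
    norm_num at h1
  · rw [← g.apply_symm_apply z, sum_map_mul_mul hg]
    exact h.sum_edge_mul_edge hki hkj hli hlj _
  · rw [← g.apply_symm_apply z, sum_map_mul_mul hg]
    exact h.sum_edge_mul_edge hki hkj hmi hmj _

theorem sum_edge_sq_mul_edge {a b c d : Fin 5} (hab : a ≠ b) :
    ∑ k : Fin 5, ((if k = a then (1 : ℝ) else 0) - if k = b then 1 else 0) *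
      ((if k = a then (1 : ℝ) else 0) - if k = b then 1 else 0) *
      ((if k = c then (1 : ℝ) else 0) - if k = d then 1 else 0) =
      (if c = a ∨ c = b then 1 else 0) - if d = a ∨ d = b then 1 else 0 := by
  have : ∀ k : Fin 5, ((if k = a then (1 : ℝ) else 0) - if k = b then 1 else 0) *
      ((if k = a then (1 : ℝ) else 0) - if k = b then 1 else 0) =
      if k = a ∨ k = b then 1 else 0 := by
    intro k
    by_cases h1 : k = a
    · subst h1; simp [hab]
    by_cases h2 : k = b
    · subst h2; simp [h1]
    · simp [h1, h2]
  simp only [this, mul_sub, Finset.sum_sub_distrib, mul_ite, mul_one, mul_zero,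
    Finset.sum_ite_eq', Finset.mem_univ, if_true]

/-- The images of two edges from a common vertex are edges from a common vertex. -/
theorem map_edge_pair (h : IsSimplexFrame w)
    (hg : ∀ x, ∑ i, inner ℝ (w i) (g x) ^ 3 = ∑ i, inner ℝ (w i) x ^ 3) {i j k : Fin 5}
    (hij : i ≠ j) (hik : i ≠ k) (hjk : j ≠ k) {a b c d : Fin 5} {t s : ℝ} (hab : a ≠ b)
    (ht : 0 < t) (hcd : c ≠ d) (hs : 0 < s)
    (h1 : ∀ k, inner ℝ (w k) (g ((4 / 5 : ℝ) • (w i - w j))) =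
        t * ((if k = a then (1 : ℝ) else 0) - if k = b then 1 else 0))
    (h2 : ∀ l, inner ℝ (w l) (g ((4 / 5 : ℝ) • (w i - w k))) =
        s * ((if l = c then (1 : ℝ) else 0) - if l = d then 1 else 0)) :
    a = c ∧ t = 1 := by
  -- The trilinear form at `(ij, ij, ik)` equals `1`. On the images it is `t ^ 2 * s` times `1`, `0`
  -- or `-1`, according to which endpoints of `cd` lie on `ab`; positivity leaves only the first
  -- value.
  have key : ∀ {j k a b c d : Fin 5} {t s : ℝ}, i ≠ j → i ≠ k → j ≠ k → a ≠ b → 0 < t → 0 < s →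
      (∀ k, inner ℝ (w k) (g ((4 / 5 : ℝ) • (w i - w j))) =
        t * ((if k = a then (1 : ℝ) else 0) - if k = b then 1 else 0)) →
      (∀ l, inner ℝ (w l) (g ((4 / 5 : ℝ) • (w i - w k))) =
        s * ((if l = c then (1 : ℝ) else 0) - if l = d then 1 else 0)) →
      t ^ 2 * s = 1 ∧ (c = a ∨ c = b) ∧ ¬(d = a ∨ d = b) := by
    intro j k a b c d t s hij hik hjk hab ht hs h1 h2
    have e := sum_map_mul_mul hg ((4 / 5 : ℝ) • (w i - w j)) ((4 / 5 : ℝ) • (w i - w j))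
      ((4 / 5 : ℝ) • (w i - w k))
    simp only [h1, h2] at e
    have e' : ∑ l, inner ℝ (w l) ((4 / 5 : ℝ) • (w i - w j)) *
        inner ℝ (w l) ((4 / 5 : ℝ) • (w i - w j)) *
        inner ℝ (w l) ((4 / 5 : ℝ) • (w i - w k)) = 1 := by
      simp only [h.inner_edge]
      rw [sum_edge_sq_mul_edge hij]
      simp [hik.symm, hjk.symm]
    rw [e'] at e
    have e2 : t ^ 2 * s * ((if c = a ∨ c = b then 1 else 0) - if d = a ∨ d = b then 1 else 0) =
        1 := by
      rw [← sum_edge_sq_mul_edge hab, Finset.mul_sum]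
      refine Eq.trans ?_ e
      exact Finset.sum_congr rfl fun l _ => by ring
    have hpos : 0 < t ^ 2 * s := by positivity
    split_ifs at e2 with hc hd hd
    · simp at e2
    · exact ⟨by linarith, hc, hd⟩
    · linarith
    · simp at e2
  obtain ⟨e1, hc, hd⟩ := key hij hik hjk hab ht hs h1 h2
  obtain ⟨e2, ha, -⟩ := key hik hij hjk.symm hcd hs ht h2 h1
  refine ⟨ha.resolve_right fun had => hd (.inl had.symm), ?_⟩
  -- By symmetry `t ^ 2 * s = 1 = s ^ 2 * t`, whose only positive solution is `t = s = 1`.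
  have hts : t = s := by
    have : t * s * (t - s) = 0 := by linear_combination e1 - e2
    exact sub_eq_zero.1 ((mul_eq_zero.1 this).resolve_left (by positivity))
  subst hts
  have : (t - 1) * (t ^ 2 + t + 1) = 0 := by linear_combination e1
  exact sub_eq_zero.1 ((mul_eq_zero.1 this).resolve_right (by positivity))

/-- A linear automorphism of the simplicial cubic form permutes the vertices of the simplex. -/
theorem exists_perm_map_vertex (h : IsSimplexFrame w)
    (hg : ∀ x, ∑ i, inner ℝ (w i) (g x) ^ 3 = ∑ i, inner ℝ (w i) x ^ 3) :
    ∃ σ : Equiv.Perm (Fin 5), ∀ i, g (w i) = w (σ i) := by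
  choose! A B t hAB ht hedge using fun (i j : Fin 5) (hij : i ≠ j) =>
    h.exists_map_edge_eq_smul hg hij
  have hA : ∀ i j k, i ≠ j → i ≠ k → A i j = A i k := by
    intro i j k hij hik
    by_cases hjk : j = k
    · rw [hjk]
    · exact (h.map_edge_pair hg hij hik hjk (hAB i j hij) (ht i j hij) (hAB i k hik) (ht i k hik)
        (hedge i j hij) (hedge i k hik)).1
  have ht1 : ∀ i j, i ≠ j → t i j = 1 := by
    intro i j hij
    obtain ⟨k, -, -, hki, hkj, -⟩ := Fin.exists_three_distinct hij
    exact (h.map_edge_pair hg hij hki.symm hkj.symm (hAB i j hij) (ht i j hij)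
      (hAB i k hki.symm) (ht i k hki.symm) (hedge i j hij) (hedge i k hki.symm)).2
  -- The head of the image of `ij` depends on `i` alone, so `A i (i + 1)` serves as the image of the
  -- vertex `i`.
  have hsucc : ∀ i : Fin 5, i ≠ i + 1 := by decide
  have hs : ∀ i j, i ≠ j → A i j = A i (i + 1) := fun i j hij => hA i j _ hij (hsucc i)
  have hB : ∀ i j, i ≠ j → B i j = A j (j + 1) := by
    intro i j hij
    have e1 := hedge i j hij (B i j)
    have e2 := hedge j i hij.symm (B i j)
    rw [show (4 / 5 : ℝ) • (w j - w i) = -((4 / 5 : ℝ) • (w i - w j)) by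
      rw [← smul_neg, neg_sub], map_neg, inner_neg_right, e1, ht1 i j hij, ht1 j i hij.symm,
      if_neg (hAB i j hij).symm, if_pos rfl] at e2
    rw [← hs j i hij.symm]
    by_contra hne
    rw [if_neg hne] at e2
    split_ifs at e2 <;> norm_num at e2
  have hmain : ∀ i j k, inner ℝ (w k) (g ((4 / 5 : ℝ) • (w i - w j))) =
      (if k = A i (i + 1) then (1 : ℝ) else 0) - if k = A j (j + 1) then 1 else 0 := by
    intro i j k
    by_cases hij : i = j
    · subst hij; simp
    · rw [hedge i j hij, ht1 i j hij, hs i j hij, hB i j hij, one_mul]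
  have hinj : Function.Injective fun i => A i (i + 1) := by
    intro i j hij
    by_contra hne
    refine h.edge_ne_zero hne (g.map_eq_zero_iff.1 (h.eq_of_inner_eq fun k => ?_))
    simp only at hij
    rw [hmain, hij, inner_zero_right, sub_self]
  have hbij := Finite.injective_iff_bijective.1 hinj
  refine ⟨Equiv.ofBijective _ hbij, fun i => h.eq_of_inner_eq fun k => ?_⟩
  -- The vertices sum to zero, so the edges from `i` recover `w i`.
  have hw : w i = (1 / 4 : ℝ) • ∑ j, (4 / 5 : ℝ) • (w i - w j) := by
    rw [← Finset.smul_sum, Finset.sum_sub_distrib, h.sum_eq_zero]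
    simp only [Finset.sum_const, Finset.card_univ, Fintype.card_fin, sub_zero]
    rw [← Nat.cast_smul_eq_nsmul ℝ, smul_smul, smul_smul]
    norm_num
  rw [hw, map_smul, map_sum, inner_smul_right, inner_sum]
  simp only [hmain, Finset.sum_sub_distrib]
  rw [hbij.sum_comp fun l => if k = l then (1 : ℝ) else 0]
  simp only [Finset.sum_const, Finset.card_univ, Fintype.card_fin, Finset.sum_ite_eq,
    Finset.mem_univ, if_true, Equiv.ofBijective_apply, h.inner_eq, nsmul_eq_mul]
  split_ifs <;> norm_num

end IsSimplexFrame

namespace IsSimplicialWith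

variable {P : MvPolynomial (Fin 4) ℝ} {K : ℝ} {w : Fin 5 → EuclideanSpace ℝ (Fin 4)}

/-- The frame identity shows that the vertices span, so a linear map is determined by the
permutation it induces on them. -/
theorem mem_polyAut_iff (h : IsSimplicialWith P K w)
    {g : EuclideanSpace ℝ (Fin 4) ≃ₗ[ℝ] EuclideanSpace ℝ (Fin 4)} :
    g ∈ polyAut P ↔ ∃ σ, h.permEquiv σ = g := by
  constructor
  · intro hg
    have hg' : ∀ x, ∑ i, inner ℝ (w i) (g x) ^ 3 = ∑ i, inner ℝ (w i) x ^ 3 := by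
      intro x
      have e : polyFun P (g⁻¹ (g x)) = polyFun P (g x) := congrFun hg (g x)
      rw [show g⁻¹ (g x) = x from g.symm_apply_apply x, h.polyFun_eq, h.polyFun_eq] at e
      exact (mul_left_cancel₀ h.ne_zero e).symm
    obtain ⟨σ, hσ⟩ := h.exists_perm_map_vertex hg'
    refine ⟨σ, ?_⟩
    ext1 x
    have hx : x = (4 / 5 : ℝ) • ∑ i, (inner ℝ (w i) x : ℝ) • w i := by
      rw [h.sum_inner_smul, smul_smul]; norm_num
    rw [h.permEquiv_apply, IsSimplexFrame.permMap_apply]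
    conv_rhs => rw [hx]
    simp only [map_smul, map_sum, hσ]
  · rintro ⟨σ, rfl⟩
    funext x
    change polyFun P ((h.permEquiv σ)⁻¹ x) = polyFun P x
    rw [← map_inv, h.permEquiv_apply, h.polyFun_eq, h.polyFun_eq]
    simp only [h.inner_permMap]
    rw [Equiv.sum_comp σ⁻¹⁻¹ fun k => inner ℝ (w k) x ^ 3]

theorem norm_apply_of_mem_polyAut (h : IsSimplicialWith P K w)
    {g : EuclideanSpace ℝ (Fin 4) ≃ₗ[ℝ] EuclideanSpace ℝ (Fin 4)} (hg : g ∈ polyAut P)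
    (x : EuclideanSpace ℝ (Fin 4)) : ‖g x‖ = ‖x‖ := by
  obtain ⟨σ, rfl⟩ := h.mem_polyAut_iff.1 hg
  exact h.norm_permMap σ x

theorem nonempty_mulEquiv (h : IsSimplicialWith P K w) :
    Nonempty (polyAut P ≃* Equiv.Perm (Fin 5)) := by
  have hrange : h.permEquiv.range = polyAut P := by
    ext g
    exact h.mem_polyAut_iff.symm
  exact ⟨((MonoidHom.ofInjective h.permEquiv_injective).trans
    (MulEquiv.subgroupCongr hrange)).symm⟩

end IsSimplicialWith

/-! ### Critical lines of the simplicial form -/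

/-- The integral coordinates of the generators of the critical lines. -/
def simplicialGeneratorCoeff : Fin 15 → Fin 4 → ℤ :=
  ![![0, 0, 0, 1],
    ![1, -1, -1, -1], ![-1, 1, -1, -1], ![-1, -1, 1, -1], ![1, 1, 1, -1],
    ![1, -1, -1, 3], ![-1, 1, -1, 3], ![-1, -1, 1, 3], ![1, 1, 1, 3],
    ![1, 0, 0, 1], ![-1, 0, 0, 1], ![0, 1, 0, 1], ![0, -1, 0, 1], ![0, 0, 1, 1], ![0, 0, -1, 1]]

theorem simplicialGenerator_apply (k : Fin 15) (i : Fin 4) :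
    simplicialGenerator k i =
      (![√5, √5, √5, 1] : Fin 4 → ℝ) i * (simplicialGeneratorCoeff k i : ℝ) := by
  fin_cases k <;> fin_cases i <;> simp [simplicialGenerator, simplicialGeneratorCoeff]

theorem inner_simplicialGenerator_ne_zero (k l : Fin 15) :
    inner ℝ (simplicialGenerator k) (simplicialGenerator l) ≠ 0 := by
  have h5 : √5 * √5 = 5 := Real.mul_self_sqrt (by norm_num)
  -- The first three coordinates are integers times `√5`, so the inner products are integers and a
  -- finite check decides.
  have key : ∀ k l : Fin 15,
      5 * (simplicialGeneratorCoeff k 0 * simplicialGeneratorCoeff l 0 +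
        simplicialGeneratorCoeff k 1 * simplicialGeneratorCoeff l 1 +
        simplicialGeneratorCoeff k 2 * simplicialGeneratorCoeff l 2) +
        simplicialGeneratorCoeff k 3 * simplicialGeneratorCoeff l 3 ≠ 0 := by decide
  have h := key k l
  have e : inner ℝ (simplicialGenerator k) (simplicialGenerator l) =
      ((5 * (simplicialGeneratorCoeff k 0 * simplicialGeneratorCoeff l 0 +
        simplicialGeneratorCoeff k 1 * simplicialGeneratorCoeff l 1 +
        simplicialGeneratorCoeff k 2 * simplicialGeneratorCoeff l 2) +
        simplicialGeneratorCoeff k 3 * simplicialGeneratorCoeff l 3 : ℤ) : ℝ) := by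
    rw [PiLp.inner_apply, Fin.sum_univ_four]
    simp only [simplicialGenerator_apply, RCLike.inner_apply, conj_trivial]
    push_cast
    simp
    linear_combination ((simplicialGeneratorCoeff k 0 : ℝ) * simplicialGeneratorCoeff l 0 +
        simplicialGeneratorCoeff k 1 * simplicialGeneratorCoeff l 1 +
        simplicialGeneratorCoeff k 2 * simplicialGeneratorCoeff l 2) * h5
  rw [e]
  exact_mod_cast h

theorem simplicialGenerator_ne_zero (k : Fin 15) : simplicialGenerator k ≠ 0 := fun h =>
  inner_simplicialGenerator_ne_zero k k (by rw [h, inner_zero_left])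

theorem span_simplicialGenerator_injective :
    Function.Injective fun k => Submodule.span ℝ {simplicialGenerator k} := by
  intro k l hkl
  by_contra hne
  -- Distinct lines are separated by a nonzero 2 × 2 minor of the integral coordinates.
  have key : ∀ k l : Fin 15, k ≠ l → ∃ i j,
      simplicialGeneratorCoeff k i * simplicialGeneratorCoeff l j ≠
        simplicialGeneratorCoeff k j * simplicialGeneratorCoeff l i := by decide
  obtain ⟨i, j, hij⟩ := key k l hne
  have hmem : simplicialGenerator k ∈ Submodule.span ℝ {simplicialGenerator l} := by
    have hkl' : Submodule.span ℝ {simplicialGenerator k} =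
      Submodule.span ℝ {simplicialGenerator l} := hkl
    rw [← hkl']
    exact Submodule.mem_span_singleton_self _
  obtain ⟨t, ht⟩ := Submodule.mem_span_singleton.1 hmem
  have hc : ∀ i, (simplicialGeneratorCoeff k i : ℝ) = t * simplicialGeneratorCoeff l i := by
    intro i
    have hi := congrArg (fun v => v i) ht
    simp only [PiLp.smul_apply, smul_eq_mul, simplicialGenerator_apply] at hi
    have hpos : (![√5, √5, √5, 1] : Fin 4 → ℝ) i ≠ 0 := by
      fin_cases i <;> simp
    refine mul_left_cancel₀ hpos ?_
    linear_combination -hi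
  apply hij
  have : (simplicialGeneratorCoeff k i : ℝ) * simplicialGeneratorCoeff l j =
      simplicialGeneratorCoeff k j * simplicialGeneratorCoeff l i := by
    rw [hc i, hc j]; ring
  exact_mod_cast this

theorem polyFun_pderiv_simplicialForm (κ : ℝ) (v : EuclideanSpace ℝ (Fin 4)) (i : Fin 4) :
    polyFun (MvPolynomial.pderiv i (simplicialForm κ)) v = √(3 * κ) / 12 *
      (![-2 * v 3 * v 0 + 2 * √5 * (v 1 * v 2), -2 * v 3 * v 1 + 2 * √5 * (v 0 * v 2),
        -2 * v 3 * v 2 + 2 * √5 * (v 0 * v 1),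
        3 * v 3 ^ 2 - (v 0 ^ 2 + v 1 ^ 2 + v 2 ^ 2)] : Fin 4 → ℝ) i := by
  fin_cases i <;>
    simp [polyFun, simplicialForm, MvPolynomial.pderiv_X] <;>
    ring_nf <;> simp

/-- The equations of the critical vectors. -/
theorem isCriticalVector_simplicialForm_iff {κ : ℝ} (hκ : 0 < κ)
    (v : EuclideanSpace ℝ (Fin 4)) :
    IsCriticalVector (simplicialForm κ) v ↔
      (v 2 * (v 0 ^ 2 - v 1 ^ 2) = 0 ∧ v 0 * (v 1 ^ 2 - v 2 ^ 2) = 0 ∧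
        v 1 * (v 2 ^ 2 - v 0 ^ 2) = 0) ∧
      v 0 * (5 * v 3 ^ 2 - (v 0 ^ 2 + v 1 ^ 2 + v 2 ^ 2)) = 2 * √5 * (v 1 * v 2 * v 3) ∧
      v 1 * (5 * v 3 ^ 2 - (v 0 ^ 2 + v 1 ^ 2 + v 2 ^ 2)) = 2 * √5 * (v 0 * v 2 * v 3) ∧
      v 2 * (5 * v 3 ^ 2 - (v 0 ^ 2 + v 1 ^ 2 + v 2 ^ 2)) = 2 * √5 * (v 0 * v 1 * v 3) := by
  have hc : √(3 * κ) / 12 ≠ 0 := by positivity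
  have h5 : √5 ≠ 0 := by positivity
  have hcr : IsCriticalVector (simplicialForm κ) v ↔ ∀ i j : Fin 4,
      v i * (![-2 * v 3 * v 0 + 2 * √5 * (v 1 * v 2), -2 * v 3 * v 1 + 2 * √5 * (v 0 * v 2),
        -2 * v 3 * v 2 + 2 * √5 * (v 0 * v 1),
        3 * v 3 ^ 2 - (v 0 ^ 2 + v 1 ^ 2 + v 2 ^ 2)] : Fin 4 → ℝ) j =
      v j * (![-2 * v 3 * v 0 + 2 * √5 * (v 1 * v 2), -2 * v 3 * v 1 + 2 * √5 * (v 0 * v 2),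
        -2 * v 3 * v 2 + 2 * √5 * (v 0 * v 1),
        3 * v 3 ^ 2 - (v 0 ^ 2 + v 1 ^ 2 + v 2 ^ 2)] : Fin 4 → ℝ) i := by
    simp only [IsCriticalVector, polyFun_pderiv_simplicialForm]
    refine forall_congr' fun i => forall_congr' fun j => ?_
    rw [mul_left_comm, mul_left_comm (v j)]
    exact mul_right_inj' hc
  rw [hcr]
  constructor
  · intro h
    have h01 := h 0 1
    have h12 := h 1 2
    have h20 := h 2 0
    have h03 := h 0 3
    have h13 := h 1 3
    have h23 := h 2 3
    simp at h01 h12 h20 h03 h13 h23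
    refine ⟨⟨?_, ?_, ?_⟩, ?_, ?_, ?_⟩
    · exact (mul_eq_zero.1 (show √5 * _ = 0 by linear_combination h01 / 2)).resolve_left h5
    · exact (mul_eq_zero.1 (show √5 * _ = 0 by linear_combination h12 / 2)).resolve_left h5
    · exact (mul_eq_zero.1 (show √5 * _ = 0 by linear_combination h20 / 2)).resolve_left h5
    · linear_combination h03
    · linear_combination h13
    · linear_combination h23
  · rintro ⟨⟨h01, h12, h20⟩, h03, h13, h23⟩ i j
    fin_cases i <;> fin_cases j <;> simp
    · linear_combination 2 * √5 * h01
    · linear_combination -2 * √5 * h20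
    · linear_combination h03
    · linear_combination -2 * √5 * h01
    · linear_combination 2 * √5 * h12
    · linear_combination h13
    · linear_combination 2 * √5 * h20
    · linear_combination -2 * √5 * h12
    · linear_combination h23
    · linear_combination -h03
    · linear_combination -h13
    · linear_combination -h23

theorem isCriticalVector_simplicialGenerator {κ : ℝ} (hκ : 0 < κ) (k : Fin 15) :
    IsCriticalVector (simplicialForm κ) (simplicialGenerator k) := by
  rw [isCriticalVector_simplicialForm_iff hκ]
  have h5 : √5 * √5 = 5 := Real.mul_self_sqrt (by norm_num)
  -- After the rescaling by `√5` the critical equations have integer coefficients.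
  have key : ∀ k : Fin 15, ∀ c, simplicialGeneratorCoeff k = c →
      (c 2 * (c 0 ^ 2 - c 1 ^ 2) = 0 ∧ c 0 * (c 1 ^ 2 - c 2 ^ 2) = 0 ∧
        c 1 * (c 2 ^ 2 - c 0 ^ 2) = 0) ∧
      c 0 * (c 3 ^ 2 - (c 0 ^ 2 + c 1 ^ 2 + c 2 ^ 2)) = 2 * (c 1 * c 2 * c 3) ∧
      c 1 * (c 3 ^ 2 - (c 0 ^ 2 + c 1 ^ 2 + c 2 ^ 2)) = 2 * (c 0 * c 2 * c 3) ∧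
      c 2 * (c 3 ^ 2 - (c 0 ^ 2 + c 1 ^ 2 + c 2 ^ 2)) = 2 * (c 0 * c 1 * c 3) := by
    simp only [forall_eq']
    decide
  simp only [simplicialGenerator_apply]
  generalize hc : simplicialGeneratorCoeff k = c
  obtain ⟨⟨k0, k1, k2⟩, k3, k4, k5⟩ := key k c hc
  rify at k0 k1 k2 k3 k4 k5
  refine ⟨⟨?_, ?_, ?_⟩, ?_, ?_, ?_⟩
  · simp only [Matrix.cons_val]; linear_combination √5 ^ 3 * k0
  · simp only [Matrix.cons_val]; linear_combination √5 ^ 3 * k1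
  · simp only [Matrix.cons_val]; linear_combination √5 ^ 3 * k2
  · simp only [Matrix.cons_val]
    linear_combination 5 * √5 * k3 - (√5 * c 0 * ((c 0 : ℝ) ^ 2 + (c 1 : ℝ) ^ 2 + (c 2 : ℝ) ^ 2) +
      2 * √5 * c 1 * c 2 * c 3) * h5
  · simp only [Matrix.cons_val]
    linear_combination 5 * √5 * k4 - (√5 * c 1 * ((c 0 : ℝ) ^ 2 + (c 1 : ℝ) ^ 2 + (c 2 : ℝ) ^ 2) +
      2 * √5 * c 0 * c 2 * c 3) * h5
  · simp only [Matrix.cons_val]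
    linear_combination 5 * √5 * k5 - (√5 * c 2 * ((c 0 : ℝ) ^ 2 + (c 1 : ℝ) ^ 2 + (c 2 : ℝ) ^ 2) +
      2 * √5 * c 0 * c 1 * c 3) * h5

theorem eq_smul_simplicialGenerator {v : EuclideanSpace ℝ (Fin 4)} (k : Fin 15) (r : ℝ)
    (h0 : v 0 = r * (√5 * simplicialGeneratorCoeff k 0))
    (h1 : v 1 = r * (√5 * simplicialGeneratorCoeff k 1))
    (h2 : v 2 = r * (√5 * simplicialGeneratorCoeff k 2))
    (h3 : v 3 = r * simplicialGeneratorCoeff k 3) :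
    ∃ k, ∃ t : ℝ, v = t • simplicialGenerator k := by
  refine ⟨k, r, ?_⟩
  ext i
  rw [PiLp.smul_apply, smul_eq_mul, simplicialGenerator_apply]
  fin_cases i
  · exact h0
  · exact h1
  · exact h2
  · simpa using h3

/-- The minors not involving `x₄` leave two possibilities for the first three coordinates: at most
one is nonzero, or all are nonzero with equal absolute value. The other minors then determine `x₄`;
`haxis` and `hdiag` solve them in the two cases. -/
theorem exists_eq_smul_simplicialGenerator {κ : ℝ} (hκ : 0 < κ) {v : EuclideanSpace ℝ (Fin 4)}
    (h : IsCriticalVector (simplicialForm κ) v) :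
    ∃ k, ∃ t : ℝ, v = t • simplicialGenerator k := by
  have h5 : √5 * √5 = 5 := Real.mul_self_sqrt (by norm_num)
  have h5n : √5 ≠ 0 := by positivity
  obtain ⟨⟨a, b, c⟩, e0, e1, e2⟩ := (isCriticalVector_simplicialForm_iff hκ v).1 h
  have haxis : ∀ x t : ℝ, x ≠ 0 → x * (5 * t ^ 2 - x ^ 2) = 0 → x = t * √5 ∨ x = -(t * √5) := by
    intro x t hx hxt
    refine sq_eq_sq_iff_eq_or_eq_neg.1 ?_
    have := (mul_eq_zero.1 hxt).resolve_left hx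
    linear_combination -this - t ^ 2 * h5
  have hdiag : ∀ s t : ℝ, s ≠ 0 → s * (5 * t ^ 2 - 3 * s ^ 2) = 2 * √5 * (s * s * t) →
      t = s / √5 * 3 ∨ t = s / √5 * -1 := by
    intro s t hs hst
    have : s * ((√5 * t - 3 * s) * (√5 * t + s)) = 0 := by
      linear_combination hst + s * t ^ 2 * h5
    rcases mul_eq_zero.1 ((mul_eq_zero.1 this).resolve_left hs) with h0 | h0
    · left; field_simp; linarith
    · right; field_simp; linarith
  have hcancel : ∀ s : ℝ, s / √5 * √5 = s := fun s => div_mul_cancel₀ s h5n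
  by_cases hx : v 0 = 0
  · by_cases hy : v 1 = 0
    · by_cases hz : v 2 = 0
      · exact eq_smul_simplicialGenerator 0 (v 3) (by simp [simplicialGeneratorCoeff, hx])
          (by simp [simplicialGeneratorCoeff, hy]) (by simp [simplicialGeneratorCoeff, hz])
          (by simp [simplicialGeneratorCoeff])
      · rw [hx, hy] at e2
        rcases haxis (v 2) (v 3) hz (by linarith) with ht | ht
        · exact eq_smul_simplicialGenerator 13 (v 3) (by simp [simplicialGeneratorCoeff, hx])
            (by simp [simplicialGeneratorCoeff, hy]) (by simp [simplicialGeneratorCoeff, ht])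
            (by simp [simplicialGeneratorCoeff])
        · exact eq_smul_simplicialGenerator 14 (v 3) (by simp [simplicialGeneratorCoeff, hx])
            (by simp [simplicialGeneratorCoeff, hy]) (by simp [simplicialGeneratorCoeff, ht])
            (by simp [simplicialGeneratorCoeff])
    · have hz : v 2 = 0 := by
        rw [hx] at c
        have := (mul_eq_zero.1 c).resolve_left hy
        simpa using this
      rw [hx, hz] at e1
      rcases haxis (v 1) (v 3) hy (by linarith) with ht | ht
      · exact eq_smul_simplicialGenerator 11 (v 3) (by simp [simplicialGeneratorCoeff, hx])
          (by simp [simplicialGeneratorCoeff, ht]) (by simp [simplicialGeneratorCoeff, hz])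
          (by simp [simplicialGeneratorCoeff])
      · exact eq_smul_simplicialGenerator 12 (v 3) (by simp [simplicialGeneratorCoeff, hx])
          (by simp [simplicialGeneratorCoeff, ht]) (by simp [simplicialGeneratorCoeff, hz])
          (by simp [simplicialGeneratorCoeff])
  have hyz := (mul_eq_zero.1 b).resolve_left hx
  by_cases hy : v 1 = 0
  · have hz : v 2 = 0 := by
      rw [hy] at hyz
      simpa using hyz
    rw [hy, hz] at e0
    rcases haxis (v 0) (v 3) hx (by linarith) with ht | ht
    · exact eq_smul_simplicialGenerator 9 (v 3) (by simp [simplicialGeneratorCoeff, ht])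
        (by simp [simplicialGeneratorCoeff, hy]) (by simp [simplicialGeneratorCoeff, hz])
        (by simp [simplicialGeneratorCoeff])
    · exact eq_smul_simplicialGenerator 10 (v 3) (by simp [simplicialGeneratorCoeff, ht])
        (by simp [simplicialGeneratorCoeff, hy]) (by simp [simplicialGeneratorCoeff, hz])
        (by simp [simplicialGeneratorCoeff])
  have hzx := (mul_eq_zero.1 c).resolve_left hy
  have hz' : v 2 = v 0 ∨ v 2 = -v 0 := sq_eq_sq_iff_eq_or_eq_neg.1 (by linarith)
  have hy' : v 1 = v 0 ∨ v 1 = -v 0 := sq_eq_sq_iff_eq_or_eq_neg.1 (by linarith)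
  -- `hdiag` is applied to `v 0` or `-v 0`, the sign being chosen so that the first three
  -- coordinates are this number times signs of product `1`.
  rcases hy' with hy' | hy' <;> rcases hz' with hz' | hz' <;> rw [hy', hz'] at e0
  · rcases hdiag (v 0) (v 3) hx (by linarith) with ht | ht
    · refine eq_smul_simplicialGenerator 8 ((v 0) / √5) ?_ ?_ ?_ (by
        simpa [simplicialGeneratorCoeff] using ht) <;>
      rw [← mul_assoc, hcancel] <;> simp [simplicialGeneratorCoeff, hy', hz']
    · refine eq_smul_simplicialGenerator 4 ((v 0) / √5) ?_ ?_ ?_ (by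
        simpa [simplicialGeneratorCoeff] using ht) <;>
      rw [← mul_assoc, hcancel] <;> simp [simplicialGeneratorCoeff, hy', hz']
  · rcases hdiag (-v 0) (v 3) (neg_ne_zero.2 hx) (by linarith) with ht | ht
    · refine eq_smul_simplicialGenerator 7 ((-v 0) / √5) ?_ ?_ ?_ (by
        simpa [simplicialGeneratorCoeff] using ht) <;>
      rw [← mul_assoc, hcancel] <;> simp [simplicialGeneratorCoeff, hy', hz']
    · refine eq_smul_simplicialGenerator 3 ((-v 0) / √5) ?_ ?_ ?_ (by
        simpa [simplicialGeneratorCoeff] using ht) <;>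
      rw [← mul_assoc, hcancel] <;> simp [simplicialGeneratorCoeff, hy', hz']
  · rcases hdiag (-v 0) (v 3) (neg_ne_zero.2 hx) (by linarith) with ht | ht
    · refine eq_smul_simplicialGenerator 6 ((-v 0) / √5) ?_ ?_ ?_ (by
        simpa [simplicialGeneratorCoeff] using ht) <;>
      rw [← mul_assoc, hcancel] <;> simp [simplicialGeneratorCoeff, hy', hz']
    · refine eq_smul_simplicialGenerator 2 ((-v 0) / √5) ?_ ?_ ?_ (by
        simpa [simplicialGeneratorCoeff] using ht) <;>
      rw [← mul_assoc, hcancel] <;> simp [simplicialGeneratorCoeff, hy', hz']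
  · rcases hdiag (v 0) (v 3) hx (by linarith) with ht | ht
    · refine eq_smul_simplicialGenerator 5 ((v 0) / √5) ?_ ?_ ?_ (by
        simpa [simplicialGeneratorCoeff] using ht) <;>
      rw [← mul_assoc, hcancel] <;> simp [simplicialGeneratorCoeff, hy', hz']
    · refine eq_smul_simplicialGenerator 1 ((v 0) / √5) ?_ ?_ ?_ (by
        simpa [simplicialGeneratorCoeff] using ht) <;>
      rw [← mul_assoc, hcancel] <;> simp [simplicialGeneratorCoeff, hy', hz']

theorem criticalLines_simplicialForm {κ : ℝ} (hκ : 0 < κ) :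
    criticalLines (simplicialForm κ) =
      Set.range (fun k => Submodule.span ℝ {simplicialGenerator k}) := by
  ext ℓ
  constructor
  · rintro ⟨v, hv, hcrit, rfl⟩
    obtain ⟨k, t, rfl⟩ := exists_eq_smul_simplicialGenerator hκ hcrit
    have ht : t ≠ 0 := fun h0 => hv (by rw [h0, zero_smul])
    exact ⟨k, (Submodule.span_singleton_smul_eq (IsUnit.mk0 t ht) _).symm⟩
  · rintro ⟨k, rfl⟩
    exact ⟨_, simplicialGenerator_ne_zero k, isCriticalVector_simplicialGenerator hκ k, rfl⟩

theorem OrthogonallyEquivalent.refl {n : ℕ} (P : MvPolynomial (Fin n) ℝ) :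
    OrthogonallyEquivalent P P :=
  ⟨LinearIsometryEquiv.refl ℝ _, rfl⟩

end

theorem mainTheorem5 (κ : ℝ) (hκ : 0 < κ) :
    (∀ P : MvPolynomial (Fin 4) ℝ, P.IsHomogeneous 3 →
      ((¬ OrthogonallyDecomposable P ∧ SolvesSystem κ P) ↔
        OrthogonallyEquivalent P (simplicialForm κ))) ∧
    (∀ P : MvPolynomial (Fin 4) ℝ, P.IsHomogeneous 3 →
      OrthogonallyEquivalent P (simplicialForm κ) →
        (∀ g ∈ polyAut P, ∀ x, ‖g x‖ = ‖x‖) ∧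
        Nonempty (polyAut P ≃* Equiv.Perm (Fin 5))) ∧
    (criticalLines (simplicialForm κ)).ncard = 15 ∧
    criticalLines (simplicialForm κ) =
      Set.range (fun k => Submodule.span ℝ {simplicialGenerator k}) ∧
    (criticalLines (simplicialForm κ)).Pairwise (fun ℓ ℓ' => ¬ ℓ.IsOrtho ℓ') := by
  have hsolve : ∀ P : MvPolynomial (Fin 4) ℝ, P.IsHomogeneous 3 →
      OrthogonallyEquivalent P (simplicialForm κ) →
        ¬ OrthogonallyDecomposable P ∧ SolvesSystem κ P := by
    intro P hP h
    obtain ⟨w, hw⟩ := h.isSimplicialWith hκ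
    refine ⟨hw.not_orthogonallyDecomposable, hw.solvesSystem hP ?_⟩
    rw [mul_pow, div_pow, Real.sq_sqrt (by positivity)]
    ring
  refine ⟨fun P hP => ⟨fun ⟨hind, h⟩ => ?_, hsolve P hP⟩, fun P _ h => ?_, ?_,
    criticalLines_simplicialForm hκ, ?_⟩
  -- The simplicial form is itself an indecomposable solution, so uniqueness applies to it and `P`.
  · obtain ⟨hind', h'⟩ := hsolve _ (isHomogeneous_simplicialForm κ) (.refl _)
    exact h.orthogonallyEquivalent hκ hP (isHomogeneous_simplicialForm κ) hind h' hind'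
  · obtain ⟨w, hw⟩ := h.isSimplicialWith hκ
    exact ⟨fun g hg => hw.norm_apply_of_mem_polyAut hg, hw.nonempty_mulEquiv⟩
  · rw [criticalLines_simplicialForm hκ, ← Set.image_univ,
      Set.ncard_image_of_injective _ span_simplicialGenerator_injective]
    simp
  · rw [criticalLines_simplicialForm hκ]
    rintro _ ⟨k, rfl⟩ _ ⟨l, rfl⟩ - hkl
    exact inner_simplicialGenerator_ne_zero k l
      (hkl.inner_eq (Submodule.mem_span_singleton_self _) (Submodule.mem_span_singleton_self _))
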